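/- Let $\mathbb{R}_n$ be the real Clifford algebra with imaginary units $e_1,\dots,e_n$ ($e_i^2=-1$, $e_ie_j=-e_je_i$ for $i\neq j$) and basis $e_A=e_{i_1}\cdots e_{i_r}$, $A=\{i_1<\dots<i_r\}$; for $s=\sum_A s_Ae_A$ put $|s|^2=\sum_A s_A^2$. Let $\mathbb{R}^{n+1}=\{s_0+s_1e_1+\dots+s_ne_n\}\subseteq\mathbb{R}_n$ be the paravectors, $\overline{s}=s_0-s_1e_1-\dots-s_ne_n$, $\mathbb{S}=\{s\in\mathbb{R}^{n+1} : s_0=0,\ |s|=1\}$, $\mathbb{C}_J=\{x+Jy : x,y\in\mathbb{R}\}$ and $e^{J\phi}=\cos\phi+J\sin\phi$ for $J\in\mathbb{S}$. For $\omega\in(0,\frac{\pi}{2})$ let $I_\omega=(-\omega,\omega)\cup(\pi-\omega,\pi+\omega)$ and let $D_\omega=\{s\in\mathbb{R}^{n+1}\setminus\{0\} : \operatorname{Arg}(s)\in I_\omega\}$ be the open double sector, where $\operatorname{Arg}(s)$ is the argument of $s$ as a complex number in a plane $\mathbb{C}_J\ni s$. **Operators.** Let $V_{\mathbb{R}}$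 be a real Banach space and $V=\{\sum_A v_A\otimes e_A : v_A\in V_{\mathbb{R}}\}$ the Clifford module with $\|v\|^2=\sum_A\|v_A\|^2$ and the left and right multiplications $sv=\sum_{A,B}(s_Bv_A)\otimes(e_Be_A)$, $vs=\sum_{A,B}(v_As_B)\otimes(e_Ae_B)$. Let $\mathcal{B}(V)$ be the set of bounded everywhere defined right-linear operators, with the operator norm, and $\mathcal{K}(V)$ the set of closed right-linear operators $T:\operatorname{dom}(T)\to V$ with two-sided linear domain. Products of an operator and a Clifford number are $(Ts)(v)=T(sv)$ and $(sT)(v)=s(Tv)$. For $T\in\mathcal{K}(V)$ and $s\in\mathbb{R}^{n+1}$ let $Q_s[T]=T^2-2s_0T+|s|^2$ with domain $\operatorname{dom}(T^2)$, $$\rho_S(T)=\{s\in\mathbb{R}^{n+1} : Q_s[T]^{-1}\in\mathcal{B}(V)\},\qquad \sigma_S(T)=\mathbb{R}^{n+1}\setminus\rho_S(T),$$ and $S_L^{-1}(s,T)=Q_s[T]^{-1}\overline{s}-TQ_s[T]^{-1}$ for $s\in\rho_S(T)$. The operator $T$ is *bisectorial of angle* $\omega\in(0,\frac{\pi}{2})$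 if $\sigma_S(T)\subseteq\overline{D_\omega}$ and for every $\varphi\in(\omega,\frac{\pi}{2})$ there is $C_\varphi\geq 0$ with $\|S_L^{-1}(s,T)\|\leq\frac{C_\varphi}{|s|}$ for all $s\in\mathbb{R}^{n+1}\setminus(D_\varphi\cup\{0\})$. **Functions.** For $\theta\in(0,\frac{\pi}{2})$ let $\mathcal{U}=\{(x,y)\in\mathbb{R}^2 : x+\mathbb{S}y\subseteq D_\theta\}$. A function $f:D_\theta\to\mathbb{R}_n$ is *left slice hyperholomorphic* if there are continuously differentiable $f_0,f_1:\mathcal{U}\to\mathbb{R}_n$ such that on $\mathcal{U}$: $f(x+Jy)=f_0(x,y)+Jf_1(x,y)$ for all $J\in\mathbb{S}$; $f_0(x,-y)=f_0(x,y)$ and $f_1(x,-y)=-f_1(x,y)$; $\partial_xf_0=\partial_yf_1$ and $\partial_yf_0=-\partial_xf_1$. Let $\mathcal{SH}_L^0(D_\theta)$ be the set of those $f$ which in addition are bounded and satisfy $\int_0^\infty|f(te^{J\phi})|\frac{dt}{t}<\infty$ for all $J\in\mathbb{S}$ and $\phi\in I_\theta$. **The integral.** For a piecewise $C^1$ curve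 $\gamma$ in $\mathbb{C}_J$ let $\int_\gamma S_L^{-1}(s,T)\,ds_J\,f(s)=\int S_L^{-1}(\gamma(t),T)\frac{\gamma'(t)}{J}f(\gamma(t))\,dt$. Let $\partial D_\varphi\cap\mathbb{C}_J$ be parametrized by the two curves $\gamma_\pm(t)=\pm|t|e^{-\operatorname{sgn}(t)J\varphi}$, $t\in\mathbb{R}\setminus\{0\}$. **Theorem.** Let $T\in\mathcal{K}(V)$ be bisectorial of angle $\omega\in(0,\frac{\pi}{2})$, let $\theta\in(\omega,\frac{\pi}{2})$ and $f\in\mathcal{SH}_L^0(D_\theta)$. Then for every $\varphi\in(\omega,\theta)$ and every $J\in\mathbb{S}$ the integral $$\int_{\partial D_\varphi\cap\mathbb{C}_J}S_L^{-1}(s,T)\,ds_J\,f(s)$$ converges absolutely in the operator norm and is an operator in $\mathcal{B}(V)$; it depends neither on $\varphi\in(\omega,\theta)$ nor on $J\in\mathbb{S}$. Consequently there is an operator $f(T)\in\mathcal{B}(V)$ with $f(T)=\frac{1}{2\pi}\int_{\partial D_\varphi\cap\mathbb{C}_J}S_L^{-1}(s,T)\,ds_J\,f(s)$ for all $\varphi\in(\omega,\theta)$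 and all $J\in\mathbb{S}$. -/

import Mathlib

open Set MeasureTheory
open scoped Real symmDiff

namespace CliffordCalculus

noncomputable section

/-! ### Clifford algebra and Clifford modules -/

/-- The Clifford module `V = { ∑_A v_A ⊗ e_A }` over the real space `E = V_ℝ`: the family of
coefficients `v_A`, where the multi-index `(i₁ < … < i_r)` is the set `A = {i₁, …, i_r}`.
The norm is `‖v‖² = ∑_A ‖v_A‖²`. -/
abbrev CliffordModule (n : ℕ) (E : Type*) : Type _ := PiLp 2 (fun _ : Finset (Fin n) => E)

/-- The Clifford numbers `ℝ_n`, `s = ∑_A s_A e_A`, with `|s|² = ∑_A s_A²`. -/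
abbrev Cl (n : ℕ) : Type := CliffordModule n ℝ

/-- The sign in `e_A e_B = ± e_{A ∆ B}`: each pair `(a, b) ∈ A × B` with `b < a` contributes one
transposition `e_a e_b = - e_b e_a`, each pair with `a = b` one factor `e_a² = -1`. -/
def mulSign {n : ℕ} (A B : Finset (Fin n)) : ℝ :=
  (-1) ^ ((A ×ˢ B).filter (fun p => p.2 ≤ p.1)).card

theorem mulSign_eq_prod {n : ℕ} (A B : Finset (Fin n)) :
    mulSign A B = ∏ a ∈ A, ∏ b ∈ B, (if b ≤ a then (-1 : ℝ) else 1) := by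
  rw [← Finset.prod_product', mulSign, Finset.prod_ite]
  simp

theorem prod_symmDiff {n : ℕ} (g : Fin n → ℝ) (hg : ∀ i, g i * g i = 1)
    (A B : Finset (Fin n)) :
    ∏ i ∈ A ∆ B, g i = (∏ i ∈ A, g i) * ∏ i ∈ B, g i := by
  have h : ∀ S : Finset (Fin n), ∏ i ∈ S, g i = ∏ i, (if i ∈ S then g i else 1) := by
    intro S
    rw [Finset.prod_ite_mem, Finset.univ_inter]
  rw [h, h A, h B, ← Finset.prod_mul_distrib]
  refine Finset.prod_congr rfl fun i _ => ?_
  by_cases hA : i ∈ A <;> by_cases hB : i ∈ B <;> simp [Finset.mem_symmDiff, hA, hB, hg]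

theorem mulSign_symmDiff_right {n : ℕ} (A B C : Finset (Fin n)) :
    mulSign A (B ∆ C) = mulSign A B * mulSign A C := by
  simp only [mulSign_eq_prod]
  rw [← Finset.prod_mul_distrib]
  refine Finset.prod_congr rfl fun a _ => prod_symmDiff _ (fun i => ?_) B C
  split_ifs <;> norm_num

theorem mulSign_symmDiff_left {n : ℕ} (A B C : Finset (Fin n)) :
    mulSign (A ∆ B) C = mulSign A C * mulSign B C := by
  simp only [mulSign_eq_prod]
  refine prod_symmDiff (fun a => ∏ b ∈ C, (if b ≤ a then (-1 : ℝ) else 1)) (fun i => ?_) A B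
  rw [← Finset.prod_mul_distrib]
  refine Finset.prod_eq_one fun b _ => ?_
  split_ifs <;> norm_num

section Module

variable {n : ℕ} {E : Type*} [NormedAddCommGroup E] [NormedSpace ℝ E]

/-- Left multiplication `s v = ∑_{A,B} (s_B v_A) ⊗ (e_B e_A)`, written through its coefficients:
the pairs with `B ∆ A = C` are `A = B ∆ C`. -/
def leftMul (s : Cl n) (v : CliffordModule n E) : CliffordModule n E :=
  WithLp.toLp 2 fun C => ∑ B, (mulSign B (B ∆ C) * s B) • v (B ∆ C)

/-- Right multiplication `v s = ∑_{A,B} (v_A s_B) ⊗ (e_A e_B)`, written through its coefficients. -/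
def rightMul (v : CliffordModule n E) (s : Cl n) : CliffordModule n E :=
  WithLp.toLp 2 fun C => ∑ B, (mulSign (B ∆ C) B * s B) • v (B ∆ C)

/-- Left multiplication by a Clifford number as a bounded operator. -/
def leftMulL (s : Cl n) : CliffordModule n E →L[ℝ] CliffordModule n E where
  toFun := leftMul s
  map_add' v w := by
    ext C
    simp [leftMul, smul_add, Finset.sum_add_distrib]
  map_smul' c v := by
    ext C
    simp only [leftMul, PiLp.smul_apply, RingHom.id_apply, Finset.smul_sum]
    exact Finset.sum_congr rfl fun B _ => smul_comm _ _ _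
  cont := by
    unfold leftMul
    fun_prop

end Module

section Ring

variable {n : ℕ}

instance instMulCl : Mul (Cl n) := ⟨leftMul⟩

/-- The basis vector `e_A`. -/
def basisVec (A : Finset (Fin n)) : Cl n := PiLp.single 2 A (1 : ℝ)

instance instOneCl : One (Cl n) := ⟨basisVec ∅⟩

theorem mul_apply (s t : Cl n) (C : Finset (Fin n)) :
    (s * t) C = ∑ B, mulSign B (B ∆ C) * s B * t (B ∆ C) := rfl

theorem one_apply (C : Finset (Fin n)) : (1 : Cl n) C = if C = ∅ then 1 else 0 := by
  change (PiLp.single 2 (∅ : Finset (Fin n)) (1 : ℝ) : Cl n) C = _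
  rw [PiLp.single_apply]

theorem basisVec_apply (A C : Finset (Fin n)) :
    (basisVec A : Cl n) C = if C = A then 1 else 0 := by
  rw [basisVec, PiLp.single_apply]

theorem Cl.mul_assoc' (s t u : Cl n) : s * t * u = s * (t * u) := by
  ext D
  simp only [mul_apply, Finset.sum_mul, Finset.mul_sum]
  rw [Finset.sum_comm]
  refine Finset.sum_congr rfl fun B _ => ?_
  refine Fintype.sum_equiv (Equiv.ofBijective (fun F => B ∆ F) ?_) _ _ fun F => ?_
  · exact Function.Involutive.bijective fun F => by simp
  · have h1 : (B ∆ F) ∆ (B ∆ D) = F ∆ D := by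
      rw [symmDiff_comm B F, symmDiff_assoc, symmDiff_symmDiff_cancel_left]
    simp only [Equiv.ofBijective_apply, h1]
    rw [mulSign_symmDiff_left B F (F ∆ D)]
    have h2 : B ∆ D = (B ∆ F) ∆ (F ∆ D) := by
      rw [symmDiff_assoc, symmDiff_symmDiff_cancel_left]
    rw [h2, mulSign_symmDiff_right B (B ∆ F) (F ∆ D)]
    have h3 : mulSign F (F ∆ D) = mulSign B (F ∆ D) * (mulSign (B ∆ F) (F ∆ D)) := by
      rw [mulSign_symmDiff_left, ← _root_.mul_assoc]
      have : mulSign B (F ∆ D) * mulSign B (F ∆ D) = 1 := by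
        unfold mulSign
        rw [← mul_pow]
        norm_num
      rw [this, one_mul]
    rw [mulSign_symmDiff_left] at h3
    linear_combination
      (mulSign B (B ∆ F) * s B * t (B ∆ F) * u (F ∆ D)) * h3

/-- The ring structure of `ℝ_n`; the additive group is the one of the normed space. -/
instance instRingCl : Ring (Cl n) where
  __ := (inferInstance : AddCommGroup (Cl n))
  mul := (· * ·)
  one := 1
  mul_assoc := Cl.mul_assoc'
  one_mul s := by
    ext C
    rw [mul_apply, Finset.sum_eq_single ∅]
    · have h : (∅ : Finset (Fin n)) ∆ C = C := bot_symmDiff C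
      simp [one_apply, mulSign, h]
    · intro B _ hB
      simp [one_apply, hB]
    · simp
  mul_one s := by
    ext C
    rw [mul_apply, Finset.sum_eq_single C]
    · simp [one_apply, mulSign]
    · intro B _ hB
      simp [one_apply, hB]
    · simp
  zero_mul s := by ext C; simp [mul_apply]
  mul_zero s := by ext C; simp [mul_apply]
  left_distrib s t u := by
    ext C
    simp [mul_apply, mul_add, Finset.sum_add_distrib]
  right_distrib s t u := by
    ext C
    simp [mul_apply, mul_add, add_mul, Finset.sum_add_distrib]

instance instAlgebraCl : Algebra ℝ (Cl n) :=
  Algebra.ofModule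
    (fun r s t => by
      ext C
      simp only [mul_apply, PiLp.smul_apply, smul_eq_mul, Finset.mul_sum]
      exact Finset.sum_congr rfl fun B _ => by ring)
    (fun r s t => by
      ext C
      simp only [mul_apply, PiLp.smul_apply, smul_eq_mul, Finset.mul_sum]
      exact Finset.sum_congr rfl fun B _ => by ring)

theorem basisVec_mul_basisVec (A B : Finset (Fin n)) :
    (basisVec A * basisVec B : Cl n) = mulSign A B • basisVec (A ∆ B) := by
  ext C
  rw [mul_apply, Finset.sum_eq_single A]
  · simp only [basisVec_apply, PiLp.smul_apply, smul_eq_mul]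
    by_cases h : C = A ∆ B
    · subst h
      simp
    · have : A ∆ C ≠ B := fun h' => h (by rw [← h', symmDiff_symmDiff_cancel_left])
      simp [h, this]
  · intro D _ hD
    simp [basisVec_apply, hD]
  · simp

/-- The imaginary units `e_i`. -/
def imagUnit (i : Fin n) : Cl n := basisVec {i}

theorem imagUnit_mul_self (i : Fin n) : (imagUnit i * imagUnit i : Cl n) = -1 := by
  have h1 : (1 : Cl n) = basisVec ∅ := rfl
  rw [imagUnit, basisVec_mul_basisVec, h1]
  simp [mulSign_eq_prod]

theorem imagUnit_anticomm {i j : Fin n} (h : i ≠ j) :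
    (imagUnit i * imagUnit j : Cl n) = -(imagUnit j * imagUnit i) := by
  rw [imagUnit, imagUnit, basisVec_mul_basisVec, basisVec_mul_basisVec, symmDiff_comm ({j} : Finset (Fin n)) {i}]
  rcases lt_or_gt_of_ne h with h | h
  · simp [mulSign_eq_prod, h.le, not_le.2 h]
  · simp [mulSign_eq_prod, h.le, not_le.2 h]

/-- `e_A = e_{i₁} ⋯ e_{i_r}` for `A = {i₁ < ⋯ < i_r}`, by splitting off the smallest index. -/
theorem basisVec_insert {i : Fin n} {A : Finset (Fin n)} (h : ∀ j ∈ A, i < j) :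
    (basisVec (insert i A) : Cl n) = imagUnit i * basisVec A := by
  have hi : i ∉ A := fun hA => lt_irrefl i (h i hA)
  have h1 : ({i} : Finset (Fin n)) ∆ A = insert i A := by
    ext j
    simp only [Finset.mem_symmDiff, Finset.mem_singleton, Finset.mem_insert]
    constructor
    · rintro (h | h)
      · exact Or.inl h.1
      · exact Or.inr h.1
    · rintro (rfl | h)
      · exact Or.inl ⟨rfl, hi⟩
      · exact Or.inr ⟨h, fun h' => hi (h' ▸ h)⟩
  rw [imagUnit, basisVec_mul_basisVec, h1, mulSign_eq_prod, Finset.prod_singleton,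
    Finset.prod_eq_one, one_smul]
  intro b hb
  rw [if_neg (not_le.2 (h b hb))]

end Ring

/-! ### Paravectors and slice hyperholomorphic functions -/

/-- The conjugate `∑_A (-1)^{|A|(|A|+1)/2} s_A e_A`. -/
def conj {n : ℕ} (s : Cl n) : Cl n :=
  WithLp.toLp 2 fun A => (-1 : ℝ) ^ (A.card * (A.card + 1) / 2) * s A

/-- The paravectors `s₀ + s₁ e₁ + ⋯ + s_n e_n`, that is `ℝ^{n+1}` inside `ℝ_n`. -/
def paravectors (n : ℕ) : Set (Cl n) := {s | ∀ A : Finset (Fin n), 1 < A.card → s A = 0}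

/-- The scalar part `s₀`. -/
def re {n : ℕ} (s : Cl n) : ℝ := s ∅

/-- `Im s = s - s₀`, which for a paravector is `s₁ e₁ + ⋯ + s_n e_n`. -/
def im {n : ℕ} (s : Cl n) : Cl n := s - re s • (1 : Cl n)

/-- The sphere `𝕊` of purely imaginary paravectors of modulus one. -/
def unitSphere (n : ℕ) : Set (Cl n) := {s | s ∈ paravectors n ∧ re s = 0 ∧ ‖s‖ = 1}

/-- The point `x + J y`. -/
def slicePoint {n : ℕ} (J : Cl n) (x y : ℝ) : Cl n := x • (1 : Cl n) + y • J

/-- `e^{Jφ} = cos φ + J sin φ`. -/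
def expJ {n : ℕ} (J : Cl n) (φ : ℝ) : Cl n := slicePoint J (Real.cos φ) (Real.sin φ)

/-- The set `𝒰 = {(x, y) | x + 𝕊 y ⊆ U}`. -/
def sliceDomain {n : ℕ} (U : Set (Cl n)) : Set (ℝ × ℝ) :=
  {p | ∀ J ∈ unitSphere n, slicePoint J p.1 p.2 ∈ U}

/-- Left slice hyperholomorphic functions `f : U → ℝ_n` on an axially symmetric open set
`U ⊆ ℝ^{n+1}` (only the values of `f` on `U` matter). -/
def IsLeftSliceHyperholomorphic {n : ℕ} (U : Set (Cl n)) (f : Cl n → Cl n) : Prop :=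
  ∃ f₀ f₁ : ℝ × ℝ → Cl n,
    ContDiffOn ℝ 1 f₀ (sliceDomain U) ∧ ContDiffOn ℝ 1 f₁ (sliceDomain U) ∧
    ∀ x y : ℝ, (x, y) ∈ sliceDomain U →
      (∀ J ∈ unitSphere n, f (slicePoint J x y) = f₀ (x, y) + J * f₁ (x, y)) ∧
      f₀ (x, -y) = f₀ (x, y) ∧ f₁ (x, -y) = -f₁ (x, y) ∧
      fderiv ℝ f₀ (x, y) (1, 0) = fderiv ℝ f₁ (x, y) (0, 1) ∧
      fderiv ℝ f₀ (x, y) (0, 1) = -fderiv ℝ f₁ (x, y) (1, 0)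

/-- The angles `I_ω = (-ω, ω) ∪ (π - ω, π + ω)`. -/
def angles (ω : ℝ) : Set ℝ := Ioo (-ω) ω ∪ Ioo (π - ω) (π + ω)

/-- The argument of a paravector as a complex number `s₀ + J |Im s|` of the plane `ℂ_J`,
`J = Im s / |Im s|`; it lies in `[0, π]`. With `-J` in place of `J` the sign changes, which does
not affect membership in the double sector. -/
def arg {n : ℕ} (s : Cl n) : ℝ := Complex.arg ⟨re s, ‖im s‖⟩

/-- The open double sector `D_ω`. -/
def doubleSector (n : ℕ) (ω : ℝ) : Set (Cl n) :=
  {s | s ∈ paravectors n ∧ s ≠ 0 ∧ arg s ∈ angles ω}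

/-- The space `𝒮ℋ_L^0(D_θ)`. -/
def SHL0 (n : ℕ) (θ : ℝ) : Set (Cl n → Cl n) :=
  {f | IsLeftSliceHyperholomorphic (doubleSector n θ) f ∧
    (∃ M : ℝ, ∀ s ∈ doubleSector n θ, ‖f s‖ ≤ M) ∧
    ∀ J ∈ unitSphere n, ∀ φ ∈ angles θ,
      IntegrableOn (fun t : ℝ => ‖f (t • expJ J φ)‖ / t) (Ioi 0)}

/-! ### Operators -/

section Operators

variable {n : ℕ} {E : Type*} [NormedAddCommGroup E] [NormedSpace ℝ E]

/-- Right-linearity of a bounded (real-linear) operator; the bounded operators with this property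
form `ℬ(V)`, and their norm is the operator norm. -/
def IsRightLinear (A : CliffordModule n E →L[ℝ] CliffordModule n E) : Prop :=
  ∀ (v : CliffordModule n E) (s : Cl n), A (rightMul v s) = rightMul (A v) s

variable (n E) in
/-- The set `𝒦(V)` of closed right-linear operators with two-sided linear domain. -/
structure ClosedOperator where
  /-- the operator as a real-linear operator on its domain -/
  op : CliffordModule n E →ₗ.[ℝ] CliffordModule n E
  leftMul_mem : ∀ (s : Cl n), ∀ v ∈ op.domain, leftMul s v ∈ op.domain
  rightMul_mem : ∀ (s : Cl n), ∀ v ∈ op.domain, rightMul v s ∈ op.domain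
  map_rightMul : ∀ (s : Cl n) (v : op.domain),
    op ⟨rightMul v.1 s, rightMul_mem s v.1 v.2⟩ = rightMul (op v) s
  closed : op.IsClosed

namespace ClosedOperator

variable (T : ClosedOperator n E)

/-- `v ∈ dom(T²)` and `w = Q_s[T] v = T² v - 2 s₀ T v + |s|² v`. -/
def QGraph (s : Cl n) (v w : CliffordModule n E) : Prop :=
  ∃ (hv : v ∈ T.op.domain) (hTv : T.op ⟨v, hv⟩ ∈ T.op.domain),
    w = T.op ⟨T.op ⟨v, hv⟩, hTv⟩ - (2 * re s) • T.op ⟨v, hv⟩ + ‖s‖ ^ 2 • v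

/-- `B ∈ ℬ(V)` and `B = Q_s[T]⁻¹`, the inverse of `Q_s[T] : dom(T²) → V`. -/
def IsQInv (s : Cl n) (B : CliffordModule n E →L[ℝ] CliffordModule n E) : Prop :=
  IsRightLinear B ∧ ∀ v w, T.QGraph s v w ↔ B w = v

/-- The `S`-resolvent set. -/
def resolventSet : Set (Cl n) := {s | s ∈ paravectors n ∧ ∃ B, T.IsQInv s B}

/-- The `S`-spectrum. -/
def spectrum : Set (Cl n) := paravectors n \ T.resolventSet

open Classical in
/-- `Q_s[T]⁻¹ ∈ ℬ(V)` for `s ∈ ρ_S(T)` (and `0` where there is no such operator). -/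
def QInv (s : Cl n) : CliffordModule n E →L[ℝ] CliffordModule n E :=
  if h : ∃ B, T.IsQInv s B then h.choose else 0

theorem QInv_mem (s : Cl n) (v : CliffordModule n E) : T.QInv s v ∈ T.op.domain := by
  unfold QInv
  split_ifs with h
  · obtain ⟨hv, -⟩ := (h.choose_spec.2 (h.choose v) v).2 rfl
    exact hv
  · exact T.op.domain.zero_mem

/-- `T Q_s[T]⁻¹` as an everywhere defined linear operator. -/
def TQInvLin (s : Cl n) : CliffordModule n E →ₗ[ℝ] CliffordModule n E :=
  T.op.toFun ∘ₗ (T.QInv s).toLinearMap.codRestrict T.op.domain (T.QInv_mem s)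

variable [CompleteSpace E]

theorem continuous_TQInvLin (s : Cl n) : Continuous (T.TQInvLin s) := by
  refine LinearMap.continuous_of_isClosed_graph _ ?_
  have h : ((T.TQInvLin s).graph : Set (CliffordModule n E × CliffordModule n E)) =
      (fun p => (T.QInv s p.1, p.2)) ⁻¹' (T.op.graph : Set _) := by
    ext ⟨v, w⟩
    simp only [SetLike.mem_coe, LinearMap.mem_graph_iff, mem_preimage, LinearPMap.mem_graph_iff]
    constructor
    · rintro rfl
      exact ⟨⟨T.QInv s v, T.QInv_mem s v⟩, rfl, rfl⟩
    · rintro ⟨⟨y, hy⟩, hy1, hy2⟩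
      simp only at hy1
      subst hy1
      exact hy2.symm
  rw [h]
  exact T.closed.preimage (by fun_prop)

/-- `T Q_s[T]⁻¹` as a bounded operator. -/
def TQInv (s : Cl n) : CliffordModule n E →L[ℝ] CliffordModule n E :=
  ⟨T.TQInvLin s, T.continuous_TQInvLin s⟩

/-- The left `S`-resolvent operator `S_L⁻¹(s, T) = Q_s[T]⁻¹ s̄ - T Q_s[T]⁻¹`, where
`(A s)(v) = A (s v)`. -/
def leftResolvent (s : Cl n) : CliffordModule n E →L[ℝ] CliffordModule n E :=
  T.QInv s ∘L leftMulL (conj s) - T.TQInv s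

/-- Bisectorial operators of angle `ω`. -/
def IsBisectorial (ω : ℝ) : Prop :=
  T.spectrum ⊆ closure (doubleSector n ω) ∧
  ∀ φ ∈ Ioo ω (π / 2), ∃ C : ℝ, 0 ≤ C ∧
    ∀ s ∈ paravectors n \ (doubleSector n φ ∪ {0}), ‖T.leftResolvent s‖ ≤ C / ‖s‖

end ClosedOperator

/-! ### The contour integral -/

/-- The integrand `G(γ(t)) (γ'(t)/J) f(γ(t))` of the path integral `∫_γ G(s) ds_J f(s)` of an
operator valued `G`; the Clifford number on the right acts by left multiplication before `G(γ(t))`,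
and `1/J = -J` because `J² = -1`. -/
def pathIntegrand (G : Cl n → CliffordModule n E →L[ℝ] CliffordModule n E) (f : Cl n → Cl n)
    (J : Cl n) (γ : ℝ → Cl n) (t : ℝ) : CliffordModule n E →L[ℝ] CliffordModule n E :=
  G (γ t) ∘L leftMulL (deriv γ t * (-J) * f (γ t))

/-- The right half `γ₊(t) = |t| e^{-sgn(t) J φ}`, `t ∈ ℝ \ {0}`, of the positively oriented
boundary of `D_φ ∩ ℂ_J`. -/
def gammaPlus (J : Cl n) (φ t : ℝ) : Cl n := |t| • expJ J (-(SignType.sign t : ℝ) * φ)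

/-- The left half `γ₋(t) = -|t| e^{-sgn(t) J φ}`, `t ∈ ℝ \ {0}`, of the positively oriented
boundary of `D_φ ∩ ℂ_J`. -/
def gammaMinus (J : Cl n) (φ t : ℝ) : Cl n := -gammaPlus J φ t

variable [CompleteSpace E]

/-- Absolute convergence, in operator norm, of `∫_{∂D_φ ∩ ℂ_J} S_L⁻¹(s, T) ds_J f(s)`. -/
def ContourIntegrable (T : ClosedOperator n E) (f : Cl n → Cl n) (φ : ℝ) (J : Cl n) : Prop :=
  Integrable (pathIntegrand T.leftResolvent f J (gammaPlus J φ)) ∧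
  Integrable (pathIntegrand T.leftResolvent f J (gammaMinus J φ))

/-- The integral `∫_{∂D_φ ∩ ℂ_J} S_L⁻¹(s, T) ds_J f(s)`, a Bochner integral in the Banach space of
bounded operators along `∂D_φ ∩ ℂ_J = γ₊ ⊕ γ₋`. -/
def contourIntegral (T : ClosedOperator n E) (f : Cl n → Cl n) (φ : ℝ) (J : Cl n) :
    CliffordModule n E →L[ℝ] CliffordModule n E :=
  (∫ t : ℝ, pathIntegrand T.leftResolvent f J (gammaPlus J φ) t) +
    ∫ t : ℝ, pathIntegrand T.leftResolvent f J (gammaMinus J φ) t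

end Operators

end

end CliffordCalculus

open CliffordCalculus

/-! The argument is Cauchy's theorem in a single plane `ℂ_J`, followed by a symmetry argument to
change the plane. The boundary of the double sector in `ℂ_J` consists of four rays, at angles `±φ`
and `π ± φ`. On each ray the bisectorial estimate bounds the resolvent by a multiple of `1/r`, so
the integrand is dominated by a multiple of `|f|/r`, which the definition of `SHL0` makes integrable
(`integrableOn_rayIntegrand`). Right-linearity survives integration.

Independence of `φ`: each ray is rotated separately inside a sector where both the resolvent and `f`
are defined (`integral_rayIntegrand_eq`). Nothing commutes here, so the problem is first made
scalar. After a real functional `Λ` is applied, `X ↦ Λ X - i Λ (X J)` is complex linear for right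
multiplication by `ℂ_J`, and coordinates `c ↦ c_A - i (J c)_A` are complex linear for left
multiplication by `ℂ_J`. The integrand becomes the real part of a finite sum of products of scalar
holomorphic functions (`dual_comp_leftMulL`). For the resolvent factor, holomorphy comes from a
resolvent identity whose divided difference has a limit (`leftResolvent_sub`,
`tendsto_resolventQuotient`); for `f` it is the Cauchy-Riemann system of `f₀`, `f₁`.

The substitution `z = e^w` turns rays into horizontal lines of a strip. The transformed function `h`
is bounded there, because the `1/|z|` of the resolvent cancels the Jacobian, and it is integrable on
every line. Such a function tends to zero along each line, so the vertical sides of large rectangles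
contribute nothing (`integral_line_eq_of_bounded_strip`).

Independence of `J`: `Q_s[T]` depends on `s` only through `s₀` and `|s|`, and `f = f₀ + J f₁` with
`f₀` even and `f₁` odd in `y`. When two conjugate rays are combined with opposite orientation, every
term containing `J` cancels (`rayIntegrand_neg_sub_rayIntegrand`). The four rays form two conjugate
pairs. -/

namespace CliffordCalculus

/-! ### Clifford modules: left and right multiplication operators, right-linearity. -/

section Module

variable {n : ℕ} {E : Type*} [NormedAddCommGroup E] [NormedSpace ℝ E]

theorem leftMul_apply (s : Cl n) (v : CliffordModule n E) (C : Finset (Fin n)) :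
    leftMul s v C = ∑ B, (mulSign B (B ∆ C) * s B) • v (B ∆ C) := rfl

theorem rightMul_apply (v : CliffordModule n E) (s : Cl n) (C : Finset (Fin n)) :
    rightMul v s C = ∑ B, (mulSign (B ∆ C) B * s B) • v (B ∆ C) := rfl

theorem mulSign_mul_self (A B : Finset (Fin n)) : mulSign A B * mulSign A B = 1 := by
  unfold mulSign
  rw [← mul_pow]
  norm_num

/-- The Clifford sign is multiplicative in each argument for symmetric difference, hence a
2-cocycle. After reindexing by `F ↦ B ∆ F` the two double sums agree term by term. -/
theorem leftMul_leftMul (s t : Cl n) (v : CliffordModule n E) :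
    leftMul s (leftMul t v) = leftMul (s * t) v := by
  symm
  ext D
  simp only [leftMul_apply, mul_apply, Finset.mul_sum, Finset.sum_smul, Finset.smul_sum, smul_smul]
  rw [Finset.sum_comm]
  refine Finset.sum_congr rfl fun B _ => ?_
  refine Fintype.sum_equiv (Equiv.ofBijective (fun F => B ∆ F) ?_) _ _ fun F => ?_
  · exact Function.Involutive.bijective fun F => by simp
  · have h1 : (B ∆ F) ∆ (B ∆ D) = F ∆ D := by
      rw [symmDiff_comm B F, symmDiff_assoc, symmDiff_symmDiff_cancel_left]
    simp only [Equiv.ofBijective_apply, h1]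
    congr 1
    rw [mulSign_symmDiff_left B F (F ∆ D)]
    have h2 : B ∆ D = (B ∆ F) ∆ (F ∆ D) := by
      rw [symmDiff_assoc, symmDiff_symmDiff_cancel_left]
    rw [h2, mulSign_symmDiff_right B (B ∆ F) (F ∆ D)]
    have h3 : mulSign F (F ∆ D) = mulSign B (F ∆ D) * (mulSign (B ∆ F) (F ∆ D)) := by
      rw [mulSign_symmDiff_left, ← _root_.mul_assoc, mulSign_mul_self, one_mul]
    rw [mulSign_symmDiff_left] at h3
    linear_combination (mulSign B (B ∆ F) * s B * t (B ∆ F)) * h3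

theorem one_leftMul (v : CliffordModule n E) : leftMul (1 : Cl n) v = v := by
  ext C
  rw [leftMul_apply, Finset.sum_eq_single ∅]
  · have h : (∅ : Finset (Fin n)) ∆ C = C := bot_symmDiff C
    simp [one_apply, mulSign, h]
  · intro B _ hB
    simp [one_apply, hB]
  · simp

/-- Associativity of the bimodule: both sides are double sums over the same index pairs, and
bimultiplicativity of the sign matches the coefficients. This is what makes left multiplications
right-linear operators. -/
theorem leftMul_rightMul (s t : Cl n) (v : CliffordModule n E) :
    leftMul s (rightMul v t) = rightMul (leftMul s v) t := by
  ext C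
  simp only [leftMul_apply, rightMul_apply, Finset.smul_sum, smul_smul]
  rw [Finset.sum_comm]
  refine Finset.sum_congr rfl fun D _ => Finset.sum_congr rfl fun B _ => ?_
  rw [symmDiff_left_comm D B C]
  congr 1
  rw [mulSign_symmDiff_left B (D ∆ C) D, symmDiff_left_comm B D C,
    mulSign_symmDiff_right B D (B ∆ C)]
  ring

theorem rightMul_add (v w : CliffordModule n E) (s : Cl n) :
    rightMul (v + w) s = rightMul v s + rightMul w s := by
  ext C
  simp [rightMul_apply, smul_add, Finset.sum_add_distrib]

theorem rightMul_smul (c : ℝ) (v : CliffordModule n E) (s : Cl n) :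
    rightMul (c • v) s = c • rightMul v s := by
  ext C
  simp only [rightMul_apply, PiLp.smul_apply, Finset.smul_sum]
  exact Finset.sum_congr rfl fun B _ => smul_comm _ _ _

/-- Right multiplication by a Clifford number as a bounded operator. -/
noncomputable def rightMulL (s : Cl n) : CliffordModule n E →L[ℝ] CliffordModule n E where
  toFun v := rightMul v s
  map_add' v w := rightMul_add v w s
  map_smul' c v := rightMul_smul c v s
  cont := by
    unfold rightMul
    fun_prop

theorem rightMulL_apply (s : Cl n) (v : CliffordModule n E) : rightMulL s v = rightMul v s := rfl

theorem leftMulL_apply (s : Cl n) (v : CliffordModule n E) : leftMulL s v = leftMul s v := rfl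

variable (n E) in
/-- Left multiplication as a bounded linear map from the Clifford numbers to the bounded
operators. -/
noncomputable def leftMulCLM : Cl n →L[ℝ] (CliffordModule n E →L[ℝ] CliffordModule n E) :=
  LinearMap.toContinuousLinearMap
    { toFun := leftMulL
      map_add' := fun s t => by
        ext v C
        simp [leftMulL_apply, leftMul_apply, mul_add, add_smul, Finset.sum_add_distrib]
      map_smul' := fun c s => by
        ext v C
        simp only [leftMulL_apply, leftMul_apply, PiLp.smul_apply, smul_eq_mul, Finset.smul_sum,
          _root_.smul_apply, RingHom.id_apply, smul_smul]
        exact Finset.sum_congr rfl fun B _ => by congr 1; ring }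

theorem leftMulL_mul (s t : Cl n) :
    (leftMulL (s * t) : CliffordModule n E →L[ℝ] CliffordModule n E) = leftMulL s ∘L leftMulL t := by
  ext1 v
  exact (leftMul_leftMul s t v).symm

theorem leftMulL_one : (leftMulL (1 : Cl n) : CliffordModule n E →L[ℝ] CliffordModule n E) = 1 := by
  ext1 v
  exact one_leftMul v

theorem leftMulL_add (s t : Cl n) :
    (leftMulL (s + t) : CliffordModule n E →L[ℝ] CliffordModule n E) = leftMulL s + leftMulL t :=
  (leftMulCLM n E).map_add s t

theorem leftMulL_sub (s t : Cl n) :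
    (leftMulL (s - t) : CliffordModule n E →L[ℝ] CliffordModule n E) = leftMulL s - leftMulL t :=
  (leftMulCLM n E).map_sub s t

theorem leftMulL_neg (s : Cl n) :
    (leftMulL (-s) : CliffordModule n E →L[ℝ] CliffordModule n E) = -leftMulL s :=
  (leftMulCLM n E).map_neg s

theorem leftMulL_smul (c : ℝ) (s : Cl n) :
    (leftMulL (c • s) : CliffordModule n E →L[ℝ] CliffordModule n E) = c • leftMulL s :=
  (leftMulCLM n E).map_smul c s

theorem leftMulL_sum {ι : Type*} (S : Finset ι) (s : ι → Cl n) :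
    (leftMulL (∑ i ∈ S, s i) : CliffordModule n E →L[ℝ] CliffordModule n E) =
      ∑ i ∈ S, leftMulL (s i) :=
  map_sum (leftMulCLM n E) s S

theorem norm_leftMulL_le (s : Cl n) :
    ‖(leftMulL s : CliffordModule n E →L[ℝ] CliffordModule n E)‖ ≤ ‖leftMulCLM n E‖ * ‖s‖ :=
  (leftMulCLM n E).le_opNorm s

theorem isRightLinear_leftMulL (s : Cl n) :
    IsRightLinear (leftMulL s : CliffordModule n E →L[ℝ] CliffordModule n E) :=
  fun v t => leftMul_rightMul s t v

theorem IsRightLinear.comp {A B : CliffordModule n E →L[ℝ] CliffordModule n E}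
    (hA : IsRightLinear A) (hB : IsRightLinear B) : IsRightLinear (A ∘L B) := fun v s => by
  simp only [ContinuousLinearMap.comp_apply, hB v s, hA (B v) s]

variable (n E) in
/-- The subspace `ℬ(V)` of the bounded right-linear operators. -/
def rightLinearSubmodule : Submodule ℝ (CliffordModule n E →L[ℝ] CliffordModule n E) where
  carrier := {A | IsRightLinear A}
  zero_mem' v s := ((rightMulL s).map_zero).symm
  add_mem' {A B} hA hB v s := by
    simp only [_root_.add_apply, hA v s, hB v s, rightMul_add]
  smul_mem' c A hA v s := by
    simp only [_root_.smul_apply, hA v s, rightMul_smul]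

theorem isRightLinear_integral {α : Type*} [MeasurableSpace α] {μ : Measure α} [CompleteSpace E]
    {A : α → CliffordModule n E →L[ℝ] CliffordModule n E} (hA : ∀ a, IsRightLinear (A a)) :
    IsRightLinear (∫ a, A a ∂μ) := by
  -- The Bochner integral of a non-integrable family is `0`, which is right-linear, so no
  -- integrability hypothesis is needed.
  by_cases hi : Integrable A μ
  · intro v s
    have h1 := ContinuousLinearMap.integral_apply hi (rightMul v s)
    have h2 := ContinuousLinearMap.integral_apply hi v
    rw [h1, h2, ← rightMulL_apply (v := ∫ a, A a v ∂μ), ← ContinuousLinearMap.integral_comp_comm]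
    · exact integral_congr_ae (Filter.Eventually.of_forall fun a => hA a v s)
    · exact hi.apply_continuousLinearMap v
  · rw [integral_undef hi]
    exact (rightLinearSubmodule n E).zero_mem

end Module

/-! ### The sphere of imaginary units and the planes `ℂ_J`. -/

section Plane

variable {n : ℕ}

theorem re_one : re (1 : Cl n) = 1 := by
  simp [re, one_apply]

theorem norm_one_cl : ‖(1 : Cl n)‖ = 1 := by
  have h : (1 : Cl n) = PiLp.single 2 (∅ : Finset (Fin n)) (1 : ℝ) := rfl
  rw [h, PiLp.norm_single]
  simp

theorem inner_one_left (s : Cl n) : inner ℝ (1 : Cl n) s = re s := by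
  simp [PiLp.inner_apply, one_apply, re]

theorem re_slicePoint {J : Cl n} (hJ : J ∈ unitSphere n) (x y : ℝ) : re (slicePoint J x y) = x := by
  have h1 : (1 : Cl n) ∅ = 1 := re_one
  have h2 : J ∅ = 0 := hJ.2.1
  simp [re, slicePoint, h1, h2]

theorem norm_slicePoint_sq {J : Cl n} (hJ : J ∈ unitSphere n) (x y : ℝ) :
    ‖slicePoint J x y‖ ^ 2 = x ^ 2 + y ^ 2 := by
  rw [slicePoint, norm_add_sq_real, inner_smul_left, inner_smul_right, inner_one_left, hJ.2.1,
    norm_smul, norm_smul, hJ.2.2, norm_one_cl]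
  simp

theorem slicePoint_mem_paravectors {J : Cl n} (hJ : J ∈ unitSphere n) (x y : ℝ) :
    slicePoint J x y ∈ paravectors n := by
  intro A hA
  have h1 : A ≠ ∅ := by rintro rfl; simp at hA
  simp [slicePoint, one_apply, h1, hJ.1 A hA]

theorem conj_slicePoint {J : Cl n} (hJ : J ∈ unitSphere n) (x y : ℝ) :
    conj (slicePoint J x y) = slicePoint J x (-y) := by
  ext A
  have h2 : J ∅ = 0 := hJ.2.1
  rcases Nat.lt_trichotomy A.card 1 with h | h | h
  · obtain rfl : A = ∅ := by simpa using h
    simp [conj, slicePoint, h2]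
  · have h1 : A ≠ ∅ := by rintro rfl; simp at h
    simp [conj, slicePoint, one_apply, h1, h]
  · have h1 : A ≠ ∅ := by rintro rfl; simp at h
    simp [conj, slicePoint, one_apply, h1, hJ.1 A h]

theorem eq_sum_imagUnit {J : Cl n} (hJ : J ∈ unitSphere n) :
    J = ∑ i, J {i} • (imagUnit i : Cl n) := by
  ext A
  have h2 : J ∅ = 0 := hJ.2.1
  have e : (∑ i, J {i} • (imagUnit i : Cl n)) A = ∑ i, J {i} * (if A = {i} then 1 else 0) := by
    rw [WithLp.ofLp_sum, Finset.sum_apply]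
    simp [imagUnit, basisVec_apply]
  rw [e]
  rcases Nat.lt_trichotomy A.card 1 with h | h | h
  · obtain rfl : A = ∅ := by simpa using h
    rw [h2, Finset.sum_eq_zero]
    intro i _
    rw [if_neg (Finset.singleton_ne_empty i).symm, mul_zero]
  · obtain ⟨i, rfl⟩ := Finset.card_eq_one.1 h
    simp
  · rw [hJ.1 A h, Finset.sum_eq_zero]
    intro i _
    rw [if_neg, mul_zero]
    rintro rfl
    simp at h

theorem inner_imagUnit (i : Fin n) (s : Cl n) : inner ℝ (imagUnit i) s = s {i} := by
  simp [PiLp.inner_apply, imagUnit, basisVec_apply]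

/-- Expand `J` in the imaginary units and add the double sum for `J * J` to its transpose.
Off-diagonal terms cancel by anticommutation, and the diagonal gives `-2 ∑ J_i² = -2`. -/
theorem unitSphere_mul_self {J : Cl n} (hJ : J ∈ unitSphere n) : J * J = -1 := by
  have hs : ∑ i, J {i} * J {i} = 1 := by
    have h : inner ℝ J J = (1 : ℝ) := by
      rw [real_inner_self_eq_norm_sq, hJ.2.2, one_pow]
    nth_rewrite 1 [eq_sum_imagUnit hJ] at h
    simpa [sum_inner, inner_smul_left, inner_imagUnit] using h
  have h1 : J * J = ∑ i, ∑ j, (J {i} * J {j}) • (imagUnit i * imagUnit j : Cl n) := by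
    nth_rewrite 1 2 [eq_sum_imagUnit hJ]
    simp only [Finset.sum_mul_sum, smul_mul_smul_comm]
  have h2 : J * J = ∑ i, ∑ j, (J {i} * J {j}) • (imagUnit j * imagUnit i : Cl n) := by
    rw [h1, Finset.sum_comm]
    simp only [mul_comm]
  have h3 : J * J + J * J = ∑ i, (J {i} * J {i}) • (-(2 : ℝ) • (1 : Cl n)) := by
    nth_rewrite 1 [h1]
    rw [h2, ← Finset.sum_add_distrib]
    refine Finset.sum_congr rfl fun i _ => ?_
    rw [← Finset.sum_add_distrib, Finset.sum_eq_single i]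
    · rw [imagUnit_mul_self]
      module
    · intro j _ hj
      rw [imagUnit_anticomm hj]
      module
    · simp
  rw [← Finset.sum_smul, hs] at h3
  have h4 : (2 : ℝ) • (J * J) = (2 : ℝ) • (-1 : Cl n) := by
    rw [two_smul, h3]
    module
  exact smul_right_injective _ two_ne_zero h4

/-- The embedding `x + i y ↦ x + J y` of the complex plane onto `ℂ_J`. -/
noncomputable def plane (J : Cl n) (z : ℂ) : Cl n := slicePoint J z.re z.im

theorem plane_neg (J : Cl n) (z : ℂ) : plane J (-z) = -plane J z := by
  simp only [plane, slicePoint, Complex.neg_re, Complex.neg_im]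
  module

theorem plane_ofReal_mul (J : Cl n) (r : ℝ) (z : ℂ) : plane J (r * z) = r • plane J z := by
  simp only [plane, slicePoint, Complex.re_ofReal_mul, Complex.im_ofReal_mul]
  module

theorem plane_I (J : Cl n) : plane J Complex.I = J := by
  simp [plane, slicePoint]

theorem plane_mul {J : Cl n} (hJ : J ∈ unitSphere n) (z w : ℂ) :
    plane J (z * w) = plane J z * plane J w := by
  simp only [plane, slicePoint, Complex.mul_re, Complex.mul_im, add_mul, mul_add,
    smul_mul_smul_comm, one_mul, mul_one, unitSphere_mul_self hJ]
  module

theorem continuous_plane (J : Cl n) : Continuous (plane J) := by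
  unfold plane slicePoint
  fun_prop

theorem norm_plane {J : Cl n} (hJ : J ∈ unitSphere n) (z : ℂ) : ‖plane J z‖ = ‖z‖ := by
  have h : ‖plane J z‖ ^ 2 = ‖z‖ ^ 2 := by
    rw [plane, norm_slicePoint_sq hJ, Complex.sq_norm, Complex.normSq_apply]
    ring
  exact (pow_left_inj₀ (norm_nonneg _) (norm_nonneg _) two_ne_zero).1 h

theorem re_plane {J : Cl n} (hJ : J ∈ unitSphere n) (z : ℂ) : re (plane J z) = z.re :=
  re_slicePoint hJ _ _

theorem plane_mem_paravectors {J : Cl n} (hJ : J ∈ unitSphere n) (z : ℂ) :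
    plane J z ∈ paravectors n := slicePoint_mem_paravectors hJ _ _

theorem conj_plane {J : Cl n} (hJ : J ∈ unitSphere n) (z : ℂ) :
    conj (plane J z) = plane J (starRingEnd ℂ z) := by
  rw [plane, conj_slicePoint hJ, plane, Complex.conj_re, Complex.conj_im]

theorem plane_ne_zero {J : Cl n} (hJ : J ∈ unitSphere n) {z : ℂ} (hz : z ≠ 0) : plane J z ≠ 0 := by
  rw [← norm_ne_zero_iff, norm_plane hJ]
  exact norm_ne_zero_iff.2 hz

theorem expJ_eq_plane (J : Cl n) (φ : ℝ) : expJ J φ = plane J (Complex.exp (φ * Complex.I)) := by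
  rw [expJ, plane, Complex.exp_ofReal_mul_I_re, Complex.exp_ofReal_mul_I_im]

end Plane

/-! ### The double sector as a cosine inequality. -/

section Sector

variable {n : ℕ}

theorem norm_im_sq {s : Cl n} : ‖im s‖ ^ 2 = ‖s‖ ^ 2 - re s ^ 2 := by
  rw [im, norm_sub_sq_real, inner_smul_right, real_inner_comm, inner_one_left, norm_smul,
    norm_one_cl]
  simp
  ring

/-- Since `arg` takes values in `[0, π]`, where the cosine is strictly decreasing, closeness of the
angle to `0` or `π` means that `|cos arg|` exceeds `cos ω`. The strict inequality excludes `s = 0`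
by itself, and this form no longer mentions angles. -/
theorem mem_doubleSector_iff {ω : ℝ} (hω : ω ∈ Ioo 0 (π / 2)) {s : Cl n} :
    s ∈ doubleSector n ω ↔ s ∈ paravectors n ∧ Real.cos ω * ‖s‖ < |re s| := by
  have hcos : 0 < Real.cos ω := Real.cos_pos_of_mem_Ioo ⟨by linarith [hω.1, Real.pi_pos], hω.2⟩
  rw [doubleSector, mem_ofPred_eq]
  refine and_congr_right fun hs => ?_
  by_cases h0 : s = 0
  · subst h0
    simp [re]
  simp only [ne_eq, h0, not_false_eq_true, true_and]
  have hn : ‖(⟨re s, ‖im s‖⟩ : ℂ)‖ = ‖s‖ := by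
    have : ‖(⟨re s, ‖im s‖⟩ : ℂ)‖ ^ 2 = ‖s‖ ^ 2 := by
      rw [Complex.sq_norm, Complex.normSq_apply, ← sq, ← sq, norm_im_sq]
      ring
    exact (pow_left_inj₀ (norm_nonneg _) (norm_nonneg _) two_ne_zero).1 this
  have hz : (⟨re s, ‖im s‖⟩ : ℂ) ≠ 0 := by
    rw [← norm_ne_zero_iff, hn]
    exact norm_ne_zero_iff.2 h0
  have hpos : 0 < ‖s‖ := norm_pos_iff.2 h0
  have hc : Real.cos (arg s) * ‖s‖ = re s := by
    rw [arg, Complex.cos_arg hz, hn, div_mul_cancel₀ _ hpos.ne']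
  have ha0 : 0 ≤ arg s := Complex.arg_nonneg_iff.2 (norm_nonneg _)
  have ha1 : arg s ≤ π := Complex.arg_le_pi _
  rw [← hc, abs_mul, abs_of_pos hpos, mul_lt_mul_iff_left₀ hpos, lt_abs, ← Real.cos_pi_sub]
  have e1 : Real.cos ω < Real.cos (arg s) ↔ arg s < ω :=
    Real.strictAntiOn_cos.lt_iff_gt ⟨hω.1.le, by linarith [hω.2, Real.pi_pos]⟩ ⟨ha0, ha1⟩
  have e2 : Real.cos ω < Real.cos (π - arg s) ↔ π - arg s < ω :=
    Real.strictAntiOn_cos.lt_iff_gt ⟨hω.1.le, by linarith [hω.2, Real.pi_pos]⟩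
      ⟨by linarith, by linarith⟩
  rw [e1, e2, angles, mem_union, mem_Ioo, mem_Ioo]
  constructor
  · rintro (h | h)
    · exact Or.inl h.2
    · exact Or.inr (by linarith [h.1])
  · rintro (h | h)
    · exact Or.inl ⟨by linarith [hω.1], h⟩
    · exact Or.inr ⟨by linarith, by linarith [hω.1]⟩

/-- One inclusion suffices: its contrapositive places every paravector with `|s₀| < cos ω |s|` in
the resolvent set of a bisectorial operator. -/
theorem closure_doubleSector_subset {ω : ℝ} (hω : ω ∈ Ioo 0 (π / 2)) :
    closure (doubleSector n ω) ⊆ {s | Real.cos ω * ‖s‖ ≤ |re s|} := by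
  refine closure_minimal (fun s hs => ((mem_doubleSector_iff hω).1 hs).2.le) ?_
  refine isClosed_le (by fun_prop) ?_
  unfold re
  fun_prop

theorem cos_lt_abs_cos {θ α : ℝ} (hθ : θ ∈ Ioo 0 (π / 2)) (hα : α ∈ angles θ) :
    Real.cos θ < |Real.cos α| := by
  have key : ∀ β, |β| < θ → Real.cos θ < Real.cos β := fun β hβ => by
    rw [← Real.cos_abs β]
    exact Real.cos_lt_cos_of_nonneg_of_le_pi (abs_nonneg β) (by linarith [hθ.2, Real.pi_pos]) hβ
  rcases hα with h | h
  · exact (key α (abs_lt.2 h)).trans_le (le_abs_self _)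
  · refine (key (α - π) (abs_lt.2 ⟨by linarith [h.1], by linarith [h.2]⟩)).trans_le ?_
    rw [Real.cos_sub_pi]
    exact neg_le_abs _

end Sector

/-! ### Cauchy's theorem on a horizontal strip and the logarithmic substitution. -/

section Strip

open Filter Topology

variable {a b M : ℝ} {h : ℂ → ℂ}

theorem isOpen_strip (a b : ℝ) : IsOpen (Complex.im ⁻¹' Ioo a b) :=
  isOpen_Ioo.preimage Complex.continuous_im

theorem add_mul_I_mem_strip {α : ℝ} (hα : α ∈ Ioo a b) (u : ℝ) :
    (u + α * Complex.I : ℂ) ∈ Complex.im ⁻¹' Ioo a b := by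
  simpa using hα

/-- A bounded holomorphic function on a strip that is integrable on a horizontal line tends to
zero along that line. -/
theorem tendsto_zero_of_bounded_strip (hd : DifferentiableOn ℂ h (Complex.im ⁻¹' Ioo a b))
    (hM : ∀ z ∈ Complex.im ⁻¹' Ioo a b, ‖h z‖ ≤ M) {α : ℝ} (hα : α ∈ Ioo a b)
    (hi : Integrable fun u : ℝ => h (u + α * Complex.I)) :
    Tendsto (fun u : ℝ => h (u + α * Complex.I)) atTop (𝓝 0) ∧
      Tendsto (fun u : ℝ => h (u + α * Complex.I)) atBot (𝓝 0) := by
  set g : ℝ → ℂ := fun u => h (u + α * Complex.I) with hg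
  set g' : ℝ → ℂ := fun u => deriv h (u + α * Complex.I) with hg'
  -- A radius independent of `u` gives, through Cauchy's estimate, a uniform bound on the derivative
  -- along the whole line.
  obtain ⟨r, hr, hball⟩ : ∃ r > 0, ∀ u : ℝ,
      Metric.closedBall (u + α * Complex.I : ℂ) r ⊆ Complex.im ⁻¹' Ioo a b := by
    refine ⟨min (α - a) (b - α) / 2, ?_, fun u z hz => ?_⟩
    · exact half_pos (lt_min (sub_pos.2 hα.1) (sub_pos.2 hα.2))
    · have h1 : |z.im - α| ≤ min (α - a) (b - α) / 2 := by
        have := (Complex.abs_im_le_norm (z - (u + α * Complex.I))).trans (mem_closedBall_iff_norm.1 hz)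
        simpa using this
      have h2 := min_le_left (α - a) (b - α)
      have h3 := min_le_right (α - a) (b - α)
      have h4 := hα.1
      have h5 := hα.2
      have := abs_le.1 h1
      constructor <;> linarith
  have hder : ∀ u, HasDerivAt g (g' u) u := fun u => by
    have hz := add_mul_I_mem_strip hα u
    have h1 : HasDerivAt h (g' u) (u + α * Complex.I) :=
      (hd.differentiableAt ((isOpen_strip a b).mem_nhds hz)).hasDerivAt
    have h2 : HasDerivAt (fun v : ℂ => v + α * Complex.I) 1 u :=
      (hasDerivAt_id _).add_const _
    have h3 := (HasDerivAt.comp (u : ℂ) h1 h2).comp_ofReal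
    simpa using h3
  have hbound : ∀ u, ‖g' u‖ ≤ M / r := fun u => by
    refine Complex.norm_deriv_le_of_forall_mem_sphere_norm_le hr ?_ fun z hz =>
      hM z (hball u (Metric.sphere_subset_closedBall hz))
    exact (hd.mono (hball u)).diffContOnCl_ball subset_rfl
  have hgc : Continuous g := continuous_iff_continuousAt.2 fun u => (hder u).continuousAt
  have hgM : ∀ u, ‖g u‖ ≤ M := fun u => hM _ (add_mul_I_mem_strip hα u)
  have hg'm : AEStronglyMeasurable g' volume := by
    have : g' = deriv g := funext fun u => (hder u).deriv.symm
    rw [this]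
    exact (stronglyMeasurable_deriv g).aestronglyMeasurable
  -- The derivative `g'` is bounded but not known to be integrable, so `g` itself is not accessible
  -- to the convergence criterion. Its square is: both `g²` and `(g²)' = 2 g g'` are products of an
  -- integrable and a bounded function.
  have hsq : ∀ u, HasDerivAt (fun u => g u * g u) (g' u * g u + g u * g' u) u := fun u =>
    (hder u).mul (hder u)
  have hi1 : Integrable fun u => g u * g u :=
    hi.bdd_mul hgc.aestronglyMeasurable (Eventually.of_forall hgM)
  have hi2 : Integrable fun u => g' u * g u + g u * g' u :=
    (hi.bdd_mul hg'm (Eventually.of_forall hbound)).add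
      (hi.mul_bdd (c := M / r) hg'm (Eventually.of_forall hbound))
  have hz : ∀ l : Filter ℝ, Tendsto (fun u => g u * g u) l (𝓝 0) → Tendsto g l (𝓝 0) := by
    intro l hl
    rw [tendsto_zero_iff_norm_tendsto_zero] at hl ⊢
    have := hl.sqrt
    simpa [norm_mul, Real.sqrt_mul_self] using this
  exact ⟨hz _ (tendsto_zero_of_hasDerivAt_of_integrableOn_Ioi (a := 0) (fun x _ => hsq x)
      hi2.integrableOn hi1.integrableOn),
    hz _ (tendsto_zero_of_hasDerivAt_of_integrableOn_Iic (a := 0) (fun x _ => hsq x)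
      hi2.integrableOn hi1.integrableOn)⟩

/-- Cauchy's theorem on a strip: the integrals of a bounded holomorphic function over horizontal
lines agree when they all converge absolutely. -/
theorem integral_line_eq_of_bounded_strip (hd : DifferentiableOn ℂ h (Complex.im ⁻¹' Ioo a b))
    (hM : ∀ z ∈ Complex.im ⁻¹' Ioo a b, ‖h z‖ ≤ M)
    (hi : ∀ α ∈ Ioo a b, Integrable fun u : ℝ => h (u + α * Complex.I)) {α β : ℝ}
    (hα : α ∈ Ioo a b) (hβ : β ∈ Ioo a b) :
    ∫ u : ℝ, h (u + α * Complex.I) = ∫ u : ℝ, h (u + β * Complex.I) := by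
  have hsub : uIcc α β ⊆ Ioo a b := ordConnected_Ioo.uIcc_subset hα hβ
  have hrect : ∀ R : ℝ, (∫ x : ℝ in -R..R, h (x + α * Complex.I)) -
      (∫ x : ℝ in -R..R, h (x + β * Complex.I)) +
      Complex.I • (∫ y : ℝ in α..β, h (R + y * Complex.I)) -
      Complex.I • (∫ y : ℝ in α..β, h ((-R : ℝ) + y * Complex.I)) = 0 := fun R => by
    have := Complex.integral_boundary_rect_eq_zero_of_differentiableOn h ⟨-R, α⟩ ⟨R, β⟩
      (hd.mono fun z hz => hsub hz.2)
    simpa using this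
  -- The vertical sides have fixed length and the integrand is bounded by `M` there, so pointwise
  -- decay along horizontal lines suffices by dominated convergence.
  have hvert : ∀ (l : Filter ℝ) [l.IsCountablyGenerated],
      (∀ y ∈ Ioo a b, Tendsto (fun u : ℝ => h (u + y * Complex.I)) l (𝓝 0)) →
      Tendsto (fun R : ℝ => ∫ y : ℝ in α..β, h (R + y * Complex.I)) l (𝓝 0) := by
    intro l _ hl
    have hsub' : uIoc α β ⊆ Ioo a b := uIoc_subset_uIcc.trans hsub
    have := intervalIntegral.tendsto_integral_filter_of_dominated_convergence (μ := volume)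
      (F := fun (R : ℝ) (y : ℝ) => h (R + y * Complex.I)) (f := fun _ => (0 : ℂ)) (l := l)
      (a := α) (b := β) (fun _ => M) ?_ ?_ intervalIntegrable_const ?_
    · simpa using this
    · refine Eventually.of_forall fun R => ContinuousOn.aestronglyMeasurable ?_ measurableSet_uIoc
      refine hd.continuousOn.comp (by fun_prop) fun y hy => add_mul_I_mem_strip (hsub' hy) R
    · exact Eventually.of_forall fun R => Eventually.of_forall fun y hy =>
        hM _ (add_mul_I_mem_strip (hsub' hy) R)
    · exact Eventually.of_forall fun y hy => hl y (hsub' hy)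
  have ht : ∀ y ∈ Ioo a b, _ := fun y hy => tendsto_zero_of_bounded_strip hd hM hy (hi y hy)
  have h1 := hvert atTop fun y hy => (ht y hy).1
  have h2 := (hvert atBot fun y hy => (ht y hy).2).comp tendsto_neg_atTop_atBot
  have h3 := intervalIntegral_tendsto_integral (hi α hα) tendsto_neg_atTop_atBot tendsto_id
  have h4 := intervalIntegral_tendsto_integral (hi β hβ) tendsto_neg_atTop_atBot tendsto_id
  have h5 := ((h3.sub h4).add (h1.const_smul Complex.I)).sub (h2.const_smul Complex.I)
  have h6 := tendsto_nhds_unique h5 ((tendsto_const_nhds (x := (0 : ℂ))).congr fun R =>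
    (hrect R).symm)
  simpa [sub_eq_zero] using h6

theorem range_exp_eq_Ioi : Real.exp '' univ = Ioi 0 := by
  rw [image_univ, Real.range_exp]

/-- The substitution `r = e^u`, which turns a ray into a horizontal line and `dt/t` into Lebesgue
measure. -/
theorem integral_exp_smul_comp_exp {F : Type*} [NormedAddCommGroup F] [NormedSpace ℝ F]
    (g : ℝ → F) : ∫ u : ℝ, Real.exp u • g (Real.exp u) = ∫ r in Ioi 0, g r := by
  have := integral_image_eq_integral_abs_deriv_smul MeasurableSet.univ
    (fun x _ => (Real.hasDerivAt_exp x).hasDerivWithinAt) Real.exp_injective.injOn g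
  rw [range_exp_eq_Ioi] at this
  simpa [abs_of_pos (Real.exp_pos _)] using this.symm

theorem integrable_exp_smul_comp_exp {F : Type*} [NormedAddCommGroup F] [NormedSpace ℝ F]
    {g : ℝ → F} : (Integrable fun u : ℝ => Real.exp u • g (Real.exp u)) ↔
      IntegrableOn g (Ioi 0) := by
  have := integrableOn_image_iff_integrableOn_abs_deriv_smul MeasurableSet.univ
    (fun x _ => (Real.hasDerivAt_exp x).hasDerivWithinAt) Real.exp_injective.injOn g
  rw [range_exp_eq_Ioi] at this
  simpa [abs_of_pos (Real.exp_pos _)] using this.symm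

end Strip

/-! ### Complex-linear functionals of operators and the `S`-resolvent. -/

section Resolvent

open Filter Topology

variable {n : ℕ} {E : Type*} [NormedAddCommGroup E] [NormedSpace ℝ E]

/-- For a real functional `Λ` on the bounded operators, the functional `X ↦ Λ X - i Λ (X J)`, which
is complex linear for the right multiplication by `ℂ_J`. -/
noncomputable def complexify (J : Cl n)
    (Λ : StrongDual ℝ (CliffordModule n E →L[ℝ] CliffordModule n E))
    (X : CliffordModule n E →L[ℝ] CliffordModule n E) : ℂ :=
  Λ X - Complex.I * Λ (X ∘L leftMulL J)

/-- Since `X J J = -X`, right multiplication by `J` permutes the two real components up to sign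
exactly as multiplication by `i` does. -/
theorem complexify_comp_plane {J : Cl n} (hJ : J ∈ unitSphere n)
    (Λ : StrongDual ℝ (CliffordModule n E →L[ℝ] CliffordModule n E))
    (X : CliffordModule n E →L[ℝ] CliffordModule n E) (z : ℂ) :
    complexify J Λ (X ∘L leftMulL (plane J z)) = z * complexify J Λ X := by
  have hJJ : X ∘L leftMulL J ∘L leftMulL J = -X := by
    rw [← leftMulL_mul, unitSphere_mul_self hJ, leftMulL_neg, leftMulL_one]
    ext1 v
    simp
  have hp : plane J z = z.re • (1 : Cl n) + z.im • J := rfl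
  have e1 : X ∘L leftMulL (plane J z) = z.re • X + z.im • (X ∘L leftMulL J) := by
    rw [hp, leftMulL_add, leftMulL_smul, leftMulL_smul, leftMulL_one]
    ext1 v
    simp
  have e2 : (X ∘L leftMulL (plane J z)) ∘L leftMulL J =
      z.re • (X ∘L leftMulL J) - z.im • X := by
    rw [e1, ContinuousLinearMap.add_comp, ContinuousLinearMap.smul_comp,
      ContinuousLinearMap.smul_comp, ContinuousLinearMap.comp_assoc, hJJ]
    module
  rw [complexify, complexify, e2, e1]
  apply Complex.ext <;> simp <;> ring

theorem re_complexify (J : Cl n) (Λ : StrongDual ℝ (CliffordModule n E →L[ℝ] CliffordModule n E))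
    (X : CliffordModule n E →L[ℝ] CliffordModule n E) : (complexify J Λ X).re = Λ X := by
  simp [complexify]

theorem complexify_sub (J : Cl n) (Λ : StrongDual ℝ (CliffordModule n E →L[ℝ] CliffordModule n E))
    (X Y : CliffordModule n E →L[ℝ] CliffordModule n E) :
    complexify J Λ (X - Y) = complexify J Λ X - complexify J Λ Y := by
  simp only [complexify, ContinuousLinearMap.sub_comp, map_sub]
  push_cast
  ring

theorem continuous_complexify (J : Cl n)
    (Λ : StrongDual ℝ (CliffordModule n E →L[ℝ] CliffordModule n E)) :
    Continuous (complexify J Λ) := by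
  unfold complexify
  have : Continuous fun X : CliffordModule n E →L[ℝ] CliffordModule n E => X ∘L leftMulL J :=
    continuous_id.mul continuous_const
  fun_prop

theorem norm_complexify_le (J : Cl n)
    (Λ : StrongDual ℝ (CliffordModule n E →L[ℝ] CliffordModule n E))
    (X : CliffordModule n E →L[ℝ] CliffordModule n E) :
    ‖complexify J Λ X‖ ≤ ‖Λ‖ * (1 + ‖(leftMulL J : CliffordModule n E →L[ℝ] _)‖) * ‖X‖ := by
  rw [complexify]
  refine (norm_sub_le _ _).trans ?_
  rw [norm_mul, Complex.norm_I, one_mul, Complex.norm_real, Complex.norm_real]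
  have h1 := Λ.le_opNorm X
  have h2 := Λ.le_opNorm (X ∘L leftMulL J)
  have h3 := mul_le_mul_of_nonneg_left
    (ContinuousLinearMap.opNorm_comp_le X (leftMulL J)) (norm_nonneg Λ)
  linarith

/-! ### Resolvent identities, norm continuity and holomorphy. -/

namespace ClosedOperator

variable (T : ClosedOperator n E)

/-- `Q_s[T]` sees only `s₀` and `|s|`, so it is constant on the spheres `x + 𝕊 y`; this is the
source of independence from `J`. -/
theorem isQInv_congr {s t : Cl n} (hre : re s = re t) (hn : ‖s‖ = ‖t‖) :
    T.IsQInv s = T.IsQInv t := by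
  funext B
  simp only [IsQInv, QGraph, hre, hn]

theorem QInv_congr {s t : Cl n} (hre : re s = re t) (hn : ‖s‖ = ‖t‖) : T.QInv s = T.QInv t := by
  have h := T.isQInv_congr hre hn
  unfold QInv
  congr! 3

variable {T} in
theorem isQInv_QInv {s : Cl n} (hs : s ∈ T.resolventSet) : T.IsQInv s (T.QInv s) := by
  unfold QInv
  rw [dif_pos hs.2]
  exact hs.2.choose_spec

theorem isRightLinear_QInv (s : Cl n) : IsRightLinear (T.QInv s) := by
  unfold QInv
  split_ifs with h
  · exact h.choose_spec.1
  · exact (rightLinearSubmodule n E).zero_mem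

variable [CompleteSpace E]

theorem TQInv_apply (s : Cl n) (v : CliffordModule n E) :
    T.TQInv s v = T.op ⟨T.QInv s v, T.QInv_mem s v⟩ := rfl

theorem TQInv_congr {s t : Cl n} (hre : re s = re t) (hn : ‖s‖ = ‖t‖) : T.TQInv s = T.TQInv t := by
  ext1 v
  simp only [TQInv_apply, T.QInv_congr hre hn]

theorem isRightLinear_TQInv (s : Cl n) : IsRightLinear (T.TQInv s) := fun v t => by
  rw [TQInv_apply, TQInv_apply, ← T.map_rightMul]
  congr 2
  exact T.isRightLinear_QInv s v t

theorem isRightLinear_leftResolvent (s : Cl n) : IsRightLinear (T.leftResolvent s) :=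
  (rightLinearSubmodule n E).sub_mem ((T.isRightLinear_QInv s).comp (isRightLinear_leftMulL _))
    (T.isRightLinear_TQInv s)

variable {T} {s t : Cl n}

/-- `T² Q_s[T]⁻¹ = 1 + 2 s₀ T Q_s[T]⁻¹ - |s|² Q_s[T]⁻¹`. -/
theorem exists_op_TQInv (hs : s ∈ T.resolventSet) (v : CliffordModule n E) :
    ∃ h : T.TQInv s v ∈ T.op.domain, T.op ⟨T.TQInv s v, h⟩ =
      v + (2 * re s) • T.TQInv s v - ‖s‖ ^ 2 • T.QInv s v := by
  obtain ⟨hv, hTv, hw⟩ := ((isQInv_QInv hs).2 (T.QInv s v) v).2 rfl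
  refine ⟨hTv, ?_⟩
  have hw' : v = T.op ⟨T.TQInv s v, hTv⟩ - (2 * re s) • T.TQInv s v + ‖s‖ ^ 2 • T.QInv s v := hw
  linear_combination (norm := module) (-1 : ℝ) • hw'

/-- `Q_s[T]⁻¹` commutes with `T` on the domain of `T`. -/
theorem QInv_op (hs : s ∈ T.resolventSet) {v : CliffordModule n E} (hv : v ∈ T.op.domain) :
    T.QInv s (T.op ⟨v, hv⟩) = T.TQInv s v := by
  obtain ⟨h, e⟩ := exists_op_TQInv hs v
  -- By `e` this vector is a combination of elements of the domain, `v` being one by hypothesis.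
  -- Hence `T.TQInv s v` lies in `dom(T²)`, and `Q_s[T]` sends it to `T v`.
  have hmem : T.op ⟨T.TQInv s v, h⟩ ∈ T.op.domain := by
    rw [e]
    exact T.op.domain.sub_mem (T.op.domain.add_mem hv (T.op.domain.smul_mem _ h))
      (T.op.domain.smul_mem _ (T.QInv_mem s v))
  refine ((isQInv_QInv hs).2 _ _).1 ⟨h, hmem, ?_⟩
  have e1 : (⟨T.op ⟨T.TQInv s v, h⟩, hmem⟩ : T.op.domain) =
      ⟨v, hv⟩ + (2 * re s) • ⟨T.TQInv s v, h⟩ - ‖s‖ ^ 2 • ⟨T.QInv s v, T.QInv_mem s v⟩ :=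
    Subtype.ext e
  rw [e1, LinearPMap.map_sub, LinearPMap.map_add, LinearPMap.map_smul, LinearPMap.map_smul,
    ← TQInv_apply]
  abel

theorem QInv_TQInv (ht : t ∈ T.resolventSet) (v : CliffordModule n E) :
    T.QInv t (T.TQInv s v) = T.TQInv t (T.QInv s v) :=
  QInv_op ht (T.QInv_mem s v)

/-- The product is read as `T² Q_t[T]⁻¹ Q_s[T]⁻¹`, with `T² Q_t[T]⁻¹` eliminated by the defining
equation. -/
theorem TQInv_TQInv (ht : t ∈ T.resolventSet) (v : CliffordModule n E) :
    T.TQInv t (T.TQInv s v) = T.QInv s v + (2 * re t) • T.TQInv t (T.QInv s v) -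
      ‖t‖ ^ 2 • T.QInv t (T.QInv s v) := by
  obtain ⟨h, e⟩ := exists_op_TQInv ht (T.QInv s v)
  rw [← e, TQInv_apply]
  congr 2
  exact QInv_TQInv ht v

/-- The same product read as `Q_t[T]⁻¹ T² Q_s[T]⁻¹`, eliminating `T² Q_s[T]⁻¹` instead. Comparing
both readings gives the resolvent identity for `Q_s[T]⁻¹`. -/
theorem TQInv_TQInv' (hs : s ∈ T.resolventSet) (ht : t ∈ T.resolventSet)
    (v : CliffordModule n E) :
    T.TQInv t (T.TQInv s v) = T.QInv t v + (2 * re s) • T.TQInv t (T.QInv s v) -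
      ‖s‖ ^ 2 • T.QInv t (T.QInv s v) := by
  obtain ⟨h, e⟩ := exists_op_TQInv hs v
  rw [← QInv_op ht h, e, map_sub, map_add, map_smul, map_smul, QInv_TQInv ht]

theorem QInv_sub_QInv (hs : s ∈ T.resolventSet) (ht : t ∈ T.resolventSet)
    (v : CliffordModule n E) :
    T.QInv s v - T.QInv t v = (2 * (re s - re t)) • T.TQInv t (T.QInv s v) +
      (‖t‖ ^ 2 - ‖s‖ ^ 2) • T.QInv t (T.QInv s v) := by
  have h1 := TQInv_TQInv (s := s) ht v
  rw [TQInv_TQInv' hs ht v] at h1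
  linear_combination (norm := module) (-1 : ℝ) • h1

/-- Apply `T` to the identity for `Q_s[T]⁻¹`, after rewriting `T Q_t[T]⁻¹ Q_s[T]⁻¹` as `Q_t[T]⁻¹ T
Q_s[T]⁻¹` so that every term visibly lies in the domain. -/
theorem TQInv_sub_TQInv (hs : s ∈ T.resolventSet) (ht : t ∈ T.resolventSet)
    (v : CliffordModule n E) :
    T.TQInv s v - T.TQInv t v = (2 * (re s - re t)) • T.TQInv t (T.TQInv s v) +
      (‖t‖ ^ 2 - ‖s‖ ^ 2) • T.TQInv t (T.QInv s v) := by
  have e1 : (⟨T.QInv s v, T.QInv_mem s v⟩ - ⟨T.QInv t v, T.QInv_mem t v⟩ : T.op.domain) =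
      (2 * (re s - re t)) • ⟨T.QInv t (T.TQInv s v), T.QInv_mem t _⟩ +
        (‖t‖ ^ 2 - ‖s‖ ^ 2) • ⟨T.QInv t (T.QInv s v), T.QInv_mem t _⟩ := by
    apply Subtype.ext
    have := QInv_sub_QInv hs ht v
    rw [← QInv_TQInv ht] at this
    exact this
  have e2 := congrArg T.op e1
  rwa [LinearPMap.map_sub, LinearPMap.map_add, LinearPMap.map_smul, LinearPMap.map_smul] at e2

theorem QInv_sub_QInv_eq_comp (hs : s ∈ T.resolventSet) (ht : t ∈ T.resolventSet) :
    T.QInv s - T.QInv t = (2 * (re s - re t)) • (T.TQInv t ∘L T.QInv s) +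
      (‖t‖ ^ 2 - ‖s‖ ^ 2) • (T.QInv t ∘L T.QInv s) := by
  ext1 v
  exact QInv_sub_QInv hs ht v

theorem TQInv_sub_TQInv_eq_comp (hs : s ∈ T.resolventSet) (ht : t ∈ T.resolventSet) :
    T.TQInv s - T.TQInv t = (2 * (re s - re t)) • (T.TQInv t ∘L T.TQInv s) +
      (‖t‖ ^ 2 - ‖s‖ ^ 2) • (T.TQInv t ∘L T.QInv s) := by
  ext1 v
  exact TQInv_sub_TQInv hs ht v

/-- Near a point of the `S`-resolvent set the operators `Q_s[T]⁻¹` and `T Q_s[T]⁻¹` are bounded. -/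
theorem eventually_norm_le {α : Type*} {l : Filter α} {u : α → Cl n}
    (hu : Tendsto u l (𝓝 t)) (hl : ∀ᶠ a in l, u a ∈ T.resolventSet) (ht : t ∈ T.resolventSet) :
    ∃ M : ℝ, ∀ᶠ a in l, ‖T.QInv (u a)‖ ≤ M ∧ ‖T.TQInv (u a)‖ ≤ M := by
  set m := ‖T.QInv t‖ + ‖T.TQInv t‖ with hm
  have hm0 : 0 ≤ m := by positivity
  -- Once the scalar coefficients satisfy `(c + d) m < 1/2`, the resolvent identities give `q ≤
  -- ‖T.QInv t‖ + q / 2`, hence `q ≤ 2m`. For `p` either `p ≤ q`, or the same absorption applies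
  -- with `p`.
  refine ⟨2 * m, ?_⟩
  have hc : Tendsto (fun a => (|2 * (re (u a) - re t)| + |‖t‖ ^ 2 - ‖u a‖ ^ 2|) * m) l (𝓝 0) := by
    have hcont : Continuous fun s : Cl n =>
        (|2 * (re s - re t)| + |‖t‖ ^ 2 - ‖s‖ ^ 2|) * m := by
      unfold re
      fun_prop
    simpa [Function.comp_def] using (hcont.tendsto t).comp hu
  filter_upwards [hl, hc.eventually (gt_mem_nhds (show (0 : ℝ) < 1 / 2 by norm_num))] with a ha hca
  set c := |2 * (re (u a) - re t)| with hc1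
  set d := |‖t‖ ^ 2 - ‖u a‖ ^ 2| with hd1
  have hc0 : 0 ≤ c := abs_nonneg _
  have hd0 : 0 ≤ d := abs_nonneg _
  set q := ‖T.QInv (u a)‖ with hq
  set p := ‖T.TQInv (u a)‖ with hp
  have hq0 : 0 ≤ q := norm_nonneg _
  have hp0 : 0 ≤ p := norm_nonneg _
  have hq1 : ‖T.QInv t‖ ≤ m := le_add_of_nonneg_right (norm_nonneg _)
  have hp1 : ‖T.TQInv t‖ ≤ m := le_add_of_nonneg_left (norm_nonneg _)
  have bound : ∀ (A B C : CliffordModule n E →L[ℝ] CliffordModule n E) (x y : ℝ), ‖A‖ ≤ m →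
      ‖x • (A ∘L B) + y • (C ∘L T.QInv (u a))‖ ≤ |x| * (m * ‖B‖) + |y| * (‖C‖ * q) := by
    intro A B C x y hA
    refine (norm_add_le _ _).trans (add_le_add ?_ ?_)
    · rw [norm_smul, Real.norm_eq_abs]
      gcongr
      exact (ContinuousLinearMap.opNorm_comp_le _ _).trans (by gcongr)
    · rw [norm_smul, Real.norm_eq_abs]
      gcongr
      exact ContinuousLinearMap.opNorm_comp_le _ _
  have e1 : q ≤ ‖T.QInv t‖ + (c * (m * q) + d * (m * q)) := by
    have h := bound (T.TQInv t) (T.QInv (u a)) (T.QInv t) (2 * (re (u a) - re t))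
      (‖t‖ ^ 2 - ‖u a‖ ^ 2) hp1
    rw [← QInv_sub_QInv_eq_comp ha ht] at h
    have h2 : d * (‖T.QInv t‖ * q) ≤ d * (m * q) := by gcongr
    have h3 := norm_le_insert' (T.QInv (u a)) (T.QInv t)
    linarith
  have e2 : p ≤ ‖T.TQInv t‖ + (c * (m * p) + d * (m * q)) := by
    have h := bound (T.TQInv t) (T.TQInv (u a)) (T.TQInv t) (2 * (re (u a) - re t))
      (‖t‖ ^ 2 - ‖u a‖ ^ 2) hp1
    rw [← TQInv_sub_TQInv_eq_comp ha ht] at h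
    have h2 : d * (‖T.TQInv t‖ * q) ≤ d * (m * q) := by gcongr
    have h3 := norm_le_insert' (T.TQInv (u a)) (T.TQInv t)
    linarith
  have h1 : q ≤ 2 * ‖T.QInv t‖ := by
    nlinarith
  have hcm : 0 ≤ c * m := by positivity
  have hdm : 0 ≤ d * m := by positivity
  constructor
  · linarith
  · rcases le_total p q with hpq | hpq
    · linarith
    · nlinarith

/-- By the resolvent identities each difference is a combination of locally bounded operators with
scalar coefficients tending to zero. -/
theorem tendsto_QInv_TQInv {α : Type*} {l : Filter α} {u : α → Cl n}
    (hu : Tendsto u l (𝓝 t)) (hl : ∀ᶠ a in l, u a ∈ T.resolventSet) (ht : t ∈ T.resolventSet) :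
    Tendsto (fun a => T.QInv (u a)) l (𝓝 (T.QInv t)) ∧
      Tendsto (fun a => T.TQInv (u a)) l (𝓝 (T.TQInv t)) := by
  obtain ⟨M, hM⟩ := eventually_norm_le hu hl ht
  have h1 : Tendsto (fun a => 2 * (re (u a) - re t)) l (𝓝 0) := by
    have hcont : Continuous fun s : Cl n => 2 * (re s - re t) := by
      unfold re
      fun_prop
    simpa [Function.comp_def] using (hcont.tendsto t).comp hu
  have h2 : Tendsto (fun a => ‖t‖ ^ 2 - ‖u a‖ ^ 2) l (𝓝 0) := by
    have hcont : Continuous fun s : Cl n => ‖t‖ ^ 2 - ‖s‖ ^ 2 := by fun_prop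
    simpa [Function.comp_def] using (hcont.tendsto t).comp hu
  have hb : ∀ (A : CliffordModule n E →L[ℝ] CliffordModule n E)
      (B : α → CliffordModule n E →L[ℝ] CliffordModule n E), (∀ᶠ a in l, ‖B a‖ ≤ M) →
      IsBoundedUnder (· ≤ ·) l (norm ∘ fun a => A ∘L B a) := fun A B hB => by
    refine ⟨‖A‖ * M, ?_⟩
    rw [eventually_map]
    filter_upwards [hB] with a ha
    exact (ContinuousLinearMap.opNorm_comp_le _ _).trans (by gcongr)
  have hq := hM.mono fun a ha => ha.1
  have hp := hM.mono fun a ha => ha.2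
  rw [← tendsto_sub_nhds_zero_iff, ← tendsto_sub_nhds_zero_iff (x := T.TQInv t)]
  constructor
  · have := (h1.zero_smul_isBoundedUnder_le (hb (T.TQInv t) _ hq)).add
      (h2.zero_smul_isBoundedUnder_le (hb (T.QInv t) _ hq))
    rw [add_zero] at this
    refine this.congr' ?_
    filter_upwards [hl] with a ha
    exact (QInv_sub_QInv_eq_comp ha ht).symm
  · have := (h1.zero_smul_isBoundedUnder_le (hb (T.TQInv t) _ hp)).add
      (h2.zero_smul_isBoundedUnder_le (hb (T.TQInv t) _ hq))
    rw [add_zero] at this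
    refine this.congr' ?_
    filter_upwards [hl] with a ha
    exact (TQInv_sub_TQInv_eq_comp ha ht).symm

variable (T) in
theorem leftResolvent_plane {J : Cl n} (hJ : J ∈ unitSphere n) (z : ℂ) :
    T.leftResolvent (plane J z) = z.re • T.QInv (plane J z) -
      z.im • (T.QInv (plane J z) ∘L leftMulL J) - T.TQInv (plane J z) := by
  have h : plane J (starRingEnd ℂ z) = z.re • (1 : Cl n) - z.im • J := by
    simp [plane, slicePoint, sub_eq_add_neg]
  rw [leftResolvent, conj_plane hJ, h, leftMulL_sub, leftMulL_smul, leftMulL_smul, leftMulL_one]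
  ext1 v
  simp

variable (T) in
/-- The real and imaginary parts of the product `R(w) R(z)` of two values of the resolvent
`R = (T - ·)⁻¹`, recombined with the right multiplication by `J`. -/
noncomputable def resolventQuotient (J : Cl n) (w z : ℂ) :
    CliffordModule n E →L[ℝ] CliffordModule n E :=
  -((T.TQInv (plane J w) - w.re • T.QInv (plane J w)) ∘L
      (T.TQInv (plane J z) - z.re • T.QInv (plane J z)) -
    (w.im * z.im) • (T.QInv (plane J w) ∘L T.QInv (plane J z))) -
  (z.im • ((T.TQInv (plane J w) - w.re • T.QInv (plane J w)) ∘L T.QInv (plane J z)) +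
    w.im • (T.QInv (plane J w) ∘L (T.TQInv (plane J z) - z.re • T.QInv (plane J z)))) ∘L leftMulL J

/-- The `S`-resolvent equation within one plane: the increment is a divided difference followed by
right multiplication by `z - w`. A functional complex linear for that multiplication therefore sees
an ordinary difference quotient. -/
theorem leftResolvent_sub {J : Cl n} (hJ : J ∈ unitSphere n) {w z : ℂ}
    (hw : plane J w ∈ T.resolventSet) (hz : plane J z ∈ T.resolventSet) :
    T.leftResolvent (plane J z) - T.leftResolvent (plane J w) =
      T.resolventQuotient J w z ∘L leftMulL (plane J (z - w)) := by
  have hn : ∀ z : ℂ, ‖plane J z‖ ^ 2 = z.re ^ 2 + z.im ^ 2 := fun z => norm_slicePoint_sq hJ _ _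
  have hJJ : ∀ v : CliffordModule n E, leftMulL J (leftMulL J v) = -v := fun v => by
    rw [leftMulL_apply, leftMulL_apply, leftMul_leftMul, unitSphere_mul_self hJ, ← leftMulL_apply,
      leftMulL_neg, leftMulL_one]
    rfl
  have hp : plane J (z - w) = (z.re - w.re) • (1 : Cl n) + (z.im - w.im) • J := rfl
  rw [T.leftResolvent_plane hJ, T.leftResolvent_plane hJ, resolventQuotient, hp,
    leftMulL_add, leftMulL_smul, leftMulL_smul, leftMulL_one]
  ext1 v
  have h1 := TQInv_TQInv (s := plane J z) hw
  have h2 := TQInv_TQInv' hz hw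
  have h3 := TQInv_sub_TQInv hz hw
  have h4 := QInv_TQInv (s := plane J z) hw
  simp only [hn, re_plane hJ] at h1 h2 h3
  simp only [_root_.sub_apply, _root_.add_apply, _root_.smul_apply, _root_.neg_apply,
    ContinuousLinearMap.comp_apply, one_apply_eq_self, map_add, map_sub, map_smul, hJJ,
    map_neg, h4]
  -- The two readings of `T Q_w[T]⁻¹ T Q_z[T]⁻¹` express `Q_z[T]⁻¹` and `Q_w[T]⁻¹` separately
  -- through products, so they may carry the different weights `z` and `w`, both on `v` and on `J
  -- v`.
  linear_combination (norm := module) -(1 : ℝ) • h3 v - z.re • h1 v + w.re • h2 v +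
    z.im • h1 (leftMulL J v) - w.im • h2 (leftMulL J v)

theorem tendsto_resolventQuotient {J : Cl n} {w : ℂ}
    (hw : plane J w ∈ T.resolventSet) {l : Filter ℂ} (hl : l ≤ 𝓝 w)
    (hev : ∀ᶠ z in l, plane J z ∈ T.resolventSet) :
    Tendsto (T.resolventQuotient J w) l (𝓝 (T.resolventQuotient J w w)) := by
  have hre : Tendsto Complex.re l (𝓝 w.re) := (Complex.continuous_re.tendsto w).mono_left hl
  have him : Tendsto Complex.im l (𝓝 w.im) := (Complex.continuous_im.tendsto w).mono_left hl
  obtain ⟨hQ, hP⟩ := tendsto_QInv_TQInv (((continuous_plane J).tendsto w).mono_left hl) hev hw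
  have hcomp : ∀ {A B : ℂ → CliffordModule n E →L[ℝ] CliffordModule n E}
      {A' B' : CliffordModule n E →L[ℝ] CliffordModule n E}, Tendsto A l (𝓝 A') →
      Tendsto B l (𝓝 B') → Tendsto (fun z => A z ∘L B z) l (𝓝 (A' ∘L B')) :=
    fun hA hB => hA.mul hB
  have hR := hP.sub (hre.smul hQ)
  unfold resolventQuotient
  exact ((hcomp tendsto_const_nhds hR).sub
    ((him.const_mul w.im).smul (hcomp tendsto_const_nhds hQ))).neg.sub
    (hcomp ((him.smul (hcomp tendsto_const_nhds hQ)).add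
      ((hcomp tendsto_const_nhds hR).const_smul w.im)) tendsto_const_nhds)

/-- The left `S`-resolvent operator is holomorphic on `ℂ_J`. -/
theorem differentiableAt_complexify_leftResolvent {J : Cl n} (hJ : J ∈ unitSphere n) {w : ℂ}
    (hev : ∀ᶠ z in 𝓝 w, plane J z ∈ T.resolventSet)
    (Λ : StrongDual ℝ (CliffordModule n E →L[ℝ] CliffordModule n E)) :
    DifferentiableAt ℂ (fun z => complexify J Λ (T.leftResolvent (plane J z))) w := by
  have hw := hev.self_of_nhds
  refine HasDerivAt.differentiableAt
    (f' := complexify J Λ (T.resolventQuotient J w w)) (hasDerivAt_iff_tendsto_slope.2 ?_)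
  have hev' := hev.filter_mono (nhdsWithin_le_nhds (s := {w}ᶜ))
  refine (((continuous_complexify J Λ).tendsto _).comp
    (tendsto_resolventQuotient hw nhdsWithin_le_nhds hev')).congr' ?_
  filter_upwards [hev', self_mem_nhdsWithin] with z hz hne
  rw [slope_def_field, ← complexify_sub, leftResolvent_sub hJ hw hz, complexify_comp_plane hJ,
    mul_div_cancel_left₀ _ (sub_ne_zero.2 hne), Function.comp_apply]

theorem continuousAt_leftResolvent {J : Cl n} (hJ : J ∈ unitSphere n) {w : ℂ}
    (hev : ∀ᶠ z in 𝓝 w, plane J z ∈ T.resolventSet) :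
    ContinuousAt (fun z => T.leftResolvent (plane J z)) w := by
  obtain ⟨hQ, hP⟩ := tendsto_QInv_TQInv ((continuous_plane J).tendsto w) hev hev.self_of_nhds
  have hre := Complex.continuous_re.tendsto w
  have him := Complex.continuous_im.tendsto w
  have hQJ : Tendsto (fun z => T.QInv (plane J z) ∘L leftMulL J) (𝓝 w)
      (𝓝 (T.QInv (plane J w) ∘L leftMulL J)) := hQ.mul tendsto_const_nhds
  unfold ContinuousAt
  simp only [T.leftResolvent_plane hJ]
  exact ((hre.smul hQ).sub (him.smul hQJ)).sub hP

end ClosedOperator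

end Resolvent

open Filter Topology

/-! ### Scalar holomorphic components of slice hyperholomorphic functions. -/

section SliceFunctions

variable {n : ℕ}

theorem mem_doubleSector_plane {θ : ℝ} (hθ : θ ∈ Ioo 0 (π / 2)) {J : Cl n}
    (hJ : J ∈ unitSphere n) {z : ℂ} :
    plane J z ∈ doubleSector n θ ↔ Real.cos θ * ‖z‖ < |z.re| := by
  rw [mem_doubleSector_iff hθ, norm_plane hJ, re_plane hJ]
  simp [plane_mem_paravectors hJ]

theorem mem_sliceDomain {θ : ℝ} (hθ : θ ∈ Ioo 0 (π / 2)) {z : ℂ}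
    (hz : Real.cos θ * ‖z‖ < |z.re|) :
    (z.re, z.im) ∈ sliceDomain (doubleSector n θ) := fun _ hJ =>
  (mem_doubleSector_plane hθ hJ).2 hz

theorem isOpen_cos_mul_norm_lt (θ : ℝ) : IsOpen {z : ℂ | Real.cos θ * ‖z‖ < |z.re|} :=
  isOpen_lt (by fun_prop) (by fun_prop)

theorem isOpen_lt_cos_mul_norm (θ : ℝ) : IsOpen {z : ℂ | |z.re| < Real.cos θ * ‖z‖} :=
  isOpen_lt (by fun_prop) (by fun_prop)

/-- The coordinate functional `c ↦ c_A - i (J c)_A`, which is complex linear for the left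
multiplication by `ℂ_J`. -/
noncomputable def leftCoord (J : Cl n) (A : Finset (Fin n)) : Cl n →L[ℝ] ℂ :=
  LinearMap.toContinuousLinearMap
    { toFun := fun c => c A - Complex.I * ((J * c) A : ℝ)
      map_add' := fun c d => by
        simp only [mul_add, PiLp.add_apply]
        push_cast
        ring
      map_smul' := fun r c => by
        simp only [mul_smul_comm, PiLp.smul_apply, smul_eq_mul, RingHom.id_apply, Complex.real_smul]
        push_cast
        ring }

theorem leftCoord_apply (J : Cl n) (A : Finset (Fin n)) (c : Cl n) :
    leftCoord J A c = c A - Complex.I * ((J * c) A : ℝ) := rfl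

theorem leftCoord_mul {J : Cl n} (hJ : J ∈ unitSphere n) (A : Finset (Fin n)) (c : Cl n) :
    leftCoord J A (J * c) = Complex.I * leftCoord J A c := by
  rw [leftCoord_apply, leftCoord_apply, ← mul_assoc, unitSphere_mul_self hJ]
  apply Complex.ext <;> simp

theorem sum_smul_basisVec (c : Cl n) : ∑ A, c A • (basisVec A : Cl n) = c := by
  ext B
  rw [WithLp.ofLp_sum, Finset.sum_apply]
  simp [basisVec_apply]

/-- The sum is `c - J (J c)`, and `J² = -1` doubles `c`. It recovers a Clifford number from its
complex coordinates with the `ℂ_J` factors on the left, next to the resolvent. -/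
theorem sum_plane_leftCoord {J : Cl n} (hJ : J ∈ unitSphere n) (c : Cl n) :
    ∑ A, plane J (leftCoord J A c) * basisVec A = (2 : ℝ) • c := by
  have h : ∀ A, plane J (leftCoord J A c) * basisVec A =
      c A • (basisVec A : Cl n) - J * ((J * c) A • basisVec A) := fun A => by
    simp [plane, slicePoint, leftCoord_apply, add_mul, sub_eq_add_neg]
  rw [Finset.sum_congr rfl fun A _ => h A, Finset.sum_sub_distrib, ← Finset.mul_sum,
    sum_smul_basisVec, sum_smul_basisVec, ← mul_assoc, unitSphere_mul_self hJ, two_smul]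
  simp

/-- The Cauchy-Riemann system for `f₀`, `f₁` is equivalent, after multiplying by `J`, to a
derivative that intertwines `i` with left multiplication by `J`. -/
theorem IsLeftSliceHyperholomorphic.exists_hasFDerivAt {θ : ℝ} (hθ : θ ∈ Ioo 0 (π / 2))
    {f : Cl n → Cl n} (hf : IsLeftSliceHyperholomorphic (doubleSector n θ) f) {J : Cl n}
    (hJ : J ∈ unitSphere n) {z : ℂ} (hz : Real.cos θ * ‖z‖ < |z.re|) :
    ∃ f' : ℂ →L[ℝ] Cl n, HasFDerivAt (fun z => f (plane J z)) f' z ∧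
      f' Complex.I = J * f' 1 := by
  obtain ⟨f₀, f₁, h₀, h₁, h⟩ := hf
  have hopen := (isOpen_cos_mul_norm_lt θ).mem_nhds hz
  have hU : sliceDomain (doubleSector n θ) ∈ 𝓝 (z.re, z.im) := by
    have hc : ContinuousAt Complex.equivRealProdCLM.symm (z.re, z.im) :=
      Complex.equivRealProdCLM.symm.continuous.continuousAt
    filter_upwards [hc.preimage_mem_nhds (t := {z : ℂ | Real.cos θ * ‖z‖ < |z.re|}) hopen] with p hp
    exact mem_sliceDomain hθ hp
  have d₀ := ((h₀.contDiffAt hU).differentiableAt one_ne_zero).hasFDerivAt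
  have d₁ := ((h₁.contDiffAt hU).differentiableAt one_ne_zero).hasFDerivAt
  have he : HasFDerivAt Complex.equivRealProdCLM
      (Complex.equivRealProdCLM : ℂ →L[ℝ] ℝ × ℝ) z := Complex.equivRealProdCLM.hasFDerivAt
  have e₀ := HasFDerivAt.comp z (f := Complex.equivRealProdCLM) d₀ he
  have e₁ := (leftMulL J : Cl n →L[ℝ] Cl n).hasFDerivAt.comp z
    (HasFDerivAt.comp z (f := Complex.equivRealProdCLM) d₁ he)
  refine ⟨_, (e₀.add e₁).congr_of_eventuallyEq ?_, ?_⟩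
  · filter_upwards [hopen] with w hw
    exact (h w.re w.im (mem_sliceDomain hθ hw)).1 J hJ
  · obtain ⟨-, -, -, c1, c2⟩ := h z.re z.im (mem_sliceDomain hθ hz)
    have i1 : Complex.equivRealProdCLM Complex.I = (0, 1) := rfl
    have i2 : Complex.equivRealProdCLM 1 = (1, 0) := rfl
    have i3 : ∀ c : Cl n, (leftMulL J : Cl n →L[ℝ] Cl n) c = J * c := fun _ => rfl
    simp only [_root_.add_apply, ContinuousLinearMap.comp_apply, ContinuousLinearEquiv.coe_coe, i1,
      i2, i3, c1, c2, mul_add, ← mul_assoc, unitSphere_mul_self hJ]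
    rw [neg_one_mul, add_comm]

theorem IsLeftSliceHyperholomorphic.differentiableAt_leftCoord {θ : ℝ} (hθ : θ ∈ Ioo 0 (π / 2))
    {f : Cl n → Cl n} (hf : IsLeftSliceHyperholomorphic (doubleSector n θ) f) {J : Cl n}
    (hJ : J ∈ unitSphere n) {z : ℂ} (hz : Real.cos θ * ‖z‖ < |z.re|) (A : Finset (Fin n)) :
    DifferentiableAt ℂ (fun z => leftCoord J A (f (plane J z))) z := by
  obtain ⟨f', hf', hCR⟩ := hf.exists_hasFDerivAt hθ hJ hz
  have h := (leftCoord J A).hasFDerivAt.comp z hf'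
  refine differentiableAt_complex_iff_differentiableAt_real.2 ⟨h.differentiableAt, ?_⟩
  rw [show (fun z => leftCoord J A (f (plane J z))) = leftCoord J A ∘ fun z => f (plane J z) from
    rfl, h.fderiv]
  simp only [ContinuousLinearMap.comp_apply, hCR, leftCoord_mul hJ, smul_eq_mul]

end SliceFunctions

/-! ### Integrals along rays. -/

section Rays

variable {n : ℕ} {E : Type*} [NormedAddCommGroup E] [NormedSpace ℝ E]

variable (n E) in
/-- Composition with a bounded operator on the right, as a bounded linear map. -/
noncomputable def compRight (B : CliffordModule n E →L[ℝ] CliffordModule n E) :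
    (CliffordModule n E →L[ℝ] CliffordModule n E) →L[ℝ]
      (CliffordModule n E →L[ℝ] CliffordModule n E) :=
  (ContinuousLinearMap.compL ℝ (CliffordModule n E) (CliffordModule n E)
    (CliffordModule n E)).flip B

/-- A real functional of `X w ds_J c` as the real part of a sum of products of complex-linear
functionals of `X` and of `c`. -/
theorem dual_comp_leftMulL {J : Cl n} (hJ : J ∈ unitSphere n)
    (Λ : StrongDual ℝ (CliffordModule n E →L[ℝ] CliffordModule n E))
    (X : CliffordModule n E →L[ℝ] CliffordModule n E) (w : ℂ) (c : Cl n) :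
    Λ (X ∘L leftMulL (plane J w * (-J) * c)) = (w * (-Complex.I / 2 *
      ∑ A, leftCoord J A c * complexify J (Λ ∘L compRight n E (leftMulL (basisVec A))) X)).re := by
  -- Only the basis vectors `e_A` fail to lie in `ℂ_J`. Being constant, they can be absorbed into
  -- the functional, which leaves complex scalars acting on `X`.
  have h1 : plane J w * (-J) * c = (2 : ℝ)⁻¹ • ∑ A,
      plane J (w * (-Complex.I) * leftCoord J A c) * basisVec A := by
    simp only [plane_mul hJ, mul_assoc (plane J w * plane J (-Complex.I))]
    rw [← Finset.mul_sum, sum_plane_leftCoord hJ, plane_neg, plane_I, mul_smul_comm,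
      inv_smul_smul₀ two_ne_zero]
  have h2 : X ∘L leftMulL (plane J w * (-J) * c) = (2 : ℝ)⁻¹ • ∑ A,
      (X ∘L leftMulL (plane J (w * (-Complex.I) * leftCoord J A c))) ∘L leftMulL (basisVec A) := by
    rw [h1, leftMulL_smul, leftMulL_sum]
    ext1 v
    simp [leftMulL_mul]
  have h3 : ∀ A, Λ ((X ∘L leftMulL (plane J (w * (-Complex.I) * leftCoord J A c))) ∘L
      leftMulL (basisVec A)) = (w * (-Complex.I) * leftCoord J A c *
        complexify J (Λ ∘L compRight n E (leftMulL (basisVec A))) X).re := fun A => by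
    rw [← complexify_comp_plane hJ, re_complexify]
    rfl
  rw [h2, map_smul, map_sum, Finset.sum_congr rfl fun A _ => h3 A, ← Complex.re_sum, smul_eq_mul,
    ← Complex.re_ofReal_mul]
  congr 1
  simp only [Finset.mul_sum]
  refine Finset.sum_congr rfl fun A _ => ?_
  push_cast
  ring

variable [CompleteSpace E]

/-- The integrand of the contour integral along the ray of angle `α` in `ℂ_J`. -/
noncomputable def rayIntegrand (T : ClosedOperator n E) (f : Cl n → Cl n) (J : Cl n) (α r : ℝ) :
    CliffordModule n E →L[ℝ] CliffordModule n E :=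
  T.leftResolvent (plane J (r * Complex.exp (α * Complex.I))) ∘L
    leftMulL (plane J (Complex.exp (α * Complex.I)) * (-J) *
      f (plane J (r * Complex.exp (α * Complex.I))))

variable {T : ClosedOperator n E} {f : Cl n → Cl n} {J : Cl n} {ω θ ψ : ℝ}

namespace ClosedOperator.IsBisectorial

theorem plane_mem_resolventSet (hT : T.IsBisectorial ω) (hω : ω ∈ Ioo 0 (π / 2))
    (hJ : J ∈ unitSphere n) {z : ℂ} (hz : |z.re| < Real.cos ω * ‖z‖) :
    plane J z ∈ T.resolventSet := by
  by_contra hn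
  have h := closure_doubleSector_subset hω (hT.1 ⟨plane_mem_paravectors hJ z, hn⟩)
  rw [mem_ofPred_eq, norm_plane hJ, re_plane hJ] at h
  exact absurd hz h.not_gt

theorem eventually_mem_resolventSet (hT : T.IsBisectorial ω) (hω : ω ∈ Ioo 0 (π / 2))
    (hJ : J ∈ unitSphere n) {z : ℂ} (hz : |z.re| < Real.cos ω * ‖z‖) :
    ∀ᶠ w in 𝓝 z, plane J w ∈ T.resolventSet := by
  filter_upwards [(isOpen_lt_cos_mul_norm ω).mem_nhds hz] with w hw
  exact hT.plane_mem_resolventSet hω hJ hw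

theorem exists_norm_leftResolvent_le (hT : T.IsBisectorial ω) (hω : ω ∈ Ioo 0 (π / 2))
    (hψ : ψ ∈ Ioo ω (π / 2)) :
    ∃ C : ℝ, 0 ≤ C ∧ ∀ J ∈ unitSphere n, ∀ z : ℂ, z ≠ 0 → |z.re| ≤ Real.cos ψ * ‖z‖ →
      ‖T.leftResolvent (plane J z)‖ ≤ C / ‖z‖ := by
  obtain ⟨C, hC, h⟩ := hT.2 ψ hψ
  refine ⟨C, hC, fun J hJ z hz hz' => ?_⟩
  rw [← norm_plane hJ z]
  refine h _ ⟨plane_mem_paravectors hJ z, ?_⟩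
  rintro (h1 | h1)
  · exact absurd ((mem_doubleSector_plane ⟨hω.1.trans hψ.1, hψ.2⟩ hJ).1 h1) hz'.not_gt
  · exact plane_ne_zero hJ hz h1

end ClosedOperator.IsBisectorial

theorem norm_ray {r : ℝ} (hr : 0 < r) (α : ℝ) : ‖(r * Complex.exp (α * Complex.I) : ℂ)‖ = r := by
  rw [norm_mul, Complex.norm_exp_ofReal_mul_I, Complex.norm_real, mul_one, Real.norm_of_nonneg hr.le]

theorem ray_ne_zero {r : ℝ} (hr : 0 < r) (α : ℝ) : (r * Complex.exp (α * Complex.I) : ℂ) ≠ 0 := by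
  rw [← norm_pos_iff, norm_ray hr]
  exact hr

theorem abs_re_ray {r : ℝ} (hr : 0 < r) (α : ℝ) :
    |(r * Complex.exp (α * Complex.I) : ℂ).re| = |Real.cos α| * r := by
  rw [Complex.re_ofReal_mul, Complex.exp_ofReal_mul_I_re, abs_mul, abs_of_pos hr, mul_comm]

theorem smul_expJ (J : Cl n) (r α : ℝ) :
    r • expJ J α = plane J (r * Complex.exp (α * Complex.I)) := by
  rw [expJ_eq_plane, plane_ofReal_mul]

theorem cos_lt_cos (hω : ω ∈ Ioo 0 (π / 2)) (hψ : ψ ∈ Ioo ω (π / 2)) :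
    Real.cos ψ < Real.cos ω :=
  Real.cos_lt_cos_of_nonneg_of_le_pi_div_two hω.1.le hψ.2.le hψ.1

/-- The estimate `C/r` for the resolvent reduces integrability to that of `|f|/r`; norm continuity
supplies measurability. The angle `ψ > ω` is a buffer: the estimate is available outside `D_ψ`,
while points there are strictly outside the closed spectral sector. -/
theorem integrableOn_rayIntegrand (hω : ω ∈ Ioo 0 (π / 2)) (hT : T.IsBisectorial ω)
    (hθ : θ ∈ Ioo 0 (π / 2)) (hf : f ∈ SHL0 n θ) (hψ : ψ ∈ Ioo ω (π / 2))
    (hJ : J ∈ unitSphere n) {α : ℝ} (hα : α ∈ angles θ) (hαψ : |Real.cos α| ≤ Real.cos ψ) :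
    IntegrableOn (rayIntegrand T f J α) (Ioi 0) := by
  obtain ⟨C, hC0, hC⟩ := hT.exists_norm_leftResolvent_le hω hψ
  obtain ⟨hslice, -, hint⟩ := hf
  set K := ‖(leftMulL (plane J (Complex.exp (α * Complex.I)) * (-J)) :
    CliffordModule n E →L[ℝ] CliffordModule n E)‖ with hK
  have hcont : ContinuousOn (rayIntegrand T f J α) (Ioi 0) := fun r hr => by
    have hr' : (0 : ℝ) < r := hr
    have hray : ContinuousAt (fun r : ℝ => (r * Complex.exp (α * Complex.I) : ℂ)) r := by fun_prop
    have h1 : ContinuousAt (fun r : ℝ => T.leftResolvent (plane J (r * Complex.exp (α * Complex.I)))) r := by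
      refine ContinuousAt.comp (f := fun r : ℝ => (r * Complex.exp (α * Complex.I) : ℂ))
        (ClosedOperator.continuousAt_leftResolvent hJ
        (hT.eventually_mem_resolventSet hω hJ ?_)) hray
      rw [abs_re_ray hr', norm_ray hr']
      exact mul_lt_mul_of_pos_right (hαψ.trans_lt (cos_lt_cos hω hψ)) hr'
    have h2 : ContinuousAt (fun r : ℝ => f (plane J (r * Complex.exp (α * Complex.I)))) r := by
      obtain ⟨f', hf', -⟩ := hslice.exists_hasFDerivAt hθ hJ
        (z := r * Complex.exp (α * Complex.I)) (by
          rw [abs_re_ray hr', norm_ray hr']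
          exact mul_lt_mul_of_pos_right (cos_lt_abs_cos hθ hα) hr')
      exact ContinuousAt.comp (f := fun r : ℝ => (r * Complex.exp (α * Complex.I) : ℂ))
        hf'.continuousAt hray
    have h3 := ((leftMulCLM n E).continuous.continuousAt).comp h2
    have h4 := h1.mul ((continuousAt_const
      (y := leftMulL (plane J (Complex.exp (α * Complex.I)) * (-J)))).mul h3)
    refine ContinuousAt.continuousWithinAt (h4.congr (Eventually.of_forall fun r => ?_))
    rw [rayIntegrand, leftMulL_mul (_ * _)]
    rfl
  refine Integrable.mono' (((hint J hJ α hα).const_mul (C * (K * ‖leftMulCLM n E‖))))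
    (hcont.aestronglyMeasurable measurableSet_Ioi) ?_
  filter_upwards [self_mem_ae_restrict measurableSet_Ioi] with r hr
  have hr' : (0 : ℝ) < r := hr
  have hG := hC J hJ _ (ray_ne_zero hr' α) (by
    rw [abs_re_ray hr', norm_ray hr']
    exact mul_le_mul_of_nonneg_right hαψ hr'.le)
  rw [norm_ray hr'] at hG
  rw [smul_expJ, rayIntegrand, leftMulL_mul]
  refine (ContinuousLinearMap.opNorm_comp_le _ _).trans ?_
  have h5 := (ContinuousLinearMap.opNorm_comp_le
    (leftMulL (plane J (Complex.exp (α * Complex.I)) * (-J)) :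
      CliffordModule n E →L[ℝ] CliffordModule n E)
    (leftMulL (f (plane J (r * Complex.exp (α * Complex.I)))))).trans
    (mul_le_mul_of_nonneg_left (norm_leftMulL_le _) (norm_nonneg _))
  refine (mul_le_mul hG h5 (norm_nonneg _) (by positivity)).trans (le_of_eq ?_)
  rw [← hK]
  ring

/-- The integral over a ray does not depend on its angle. -/
theorem integral_rayIntegrand_eq (hω : ω ∈ Ioo 0 (π / 2)) (hT : T.IsBisectorial ω)
    (hθ : θ ∈ Ioo 0 (π / 2)) (hf : f ∈ SHL0 n θ) (hψ : ψ ∈ Ioo ω (π / 2))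
    (hJ : J ∈ unitSphere n) {a b : ℝ} (hab : Ioo a b ⊆ angles θ)
    (hψ' : ∀ α ∈ Ioo a b, |Real.cos α| ≤ Real.cos ψ) {α β : ℝ} (hα : α ∈ Ioo a b)
    (hβ : β ∈ Ioo a b) :
    ∫ r in Ioi 0, rayIntegrand T f J α r = ∫ r in Ioi 0, rayIntegrand T f J β r := by
  -- By Hahn-Banach it is enough to compare values of real functionals, to which the scalar Cauchy
  -- theorem applies.
  rw [SeparatingDual.eq_iff_forall_dual_eq (R := ℝ)]
  intro Λ
  obtain ⟨C, hC0, hC⟩ := hT.exists_norm_leftResolvent_le hω hψ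
  have hint' := fun α (hα : α ∈ Ioo a b) =>
    integrableOn_rayIntegrand hω hT hθ hf hψ hJ (hab hα) (hψ' α hα)
  obtain ⟨hslice, ⟨M, hM⟩, hint⟩ := hf
  set Γ : Finset (Fin n) → StrongDual ℝ (CliffordModule n E →L[ℝ] CliffordModule n E) :=
    fun A => Λ ∘L compRight n E (leftMulL (basisVec A)) with hΓ
  set H : ℂ → ℂ := fun z => -Complex.I / 2 *
    ∑ A, leftCoord J A (f (plane J z)) * complexify J (Γ A) (T.leftResolvent (plane J z)) with hH
  -- Logarithmic coordinate: `H(z) dz` becomes `h(w) dw` with `z = e^w`, and the ray of angle `α`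
  -- becomes the line `Im w = α`.
  set h : ℂ → ℂ := fun w => Complex.exp w * H (Complex.exp w) with hh
  have hexp : ∀ w : ℂ, Complex.exp w = Real.exp w.re * Complex.exp (w.im * Complex.I) := fun w => by
    rw [Complex.ofReal_exp, ← Complex.exp_add, Complex.re_add_im]
  have hlow : ∀ w ∈ Complex.im ⁻¹' Ioo a b,
      Real.cos θ * ‖Complex.exp w‖ < |(Complex.exp w).re| := fun w hw => by
    rw [hexp, abs_re_ray (Real.exp_pos _), norm_ray (Real.exp_pos _)]
    exact mul_lt_mul_of_pos_right (cos_lt_abs_cos hθ (hab hw)) (Real.exp_pos _)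
  have hup : ∀ w ∈ Complex.im ⁻¹' Ioo a b,
      |(Complex.exp w).re| ≤ Real.cos ψ * ‖Complex.exp w‖ := fun w hw => by
    rw [hexp, abs_re_ray (Real.exp_pos _), norm_ray (Real.exp_pos _)]
    exact mul_le_mul_of_nonneg_right (hψ' _ hw) (Real.exp_pos _).le
  have hd : DifferentiableOn ℂ h (Complex.im ⁻¹' Ioo a b) := fun w hw => by
    refine DifferentiableAt.differentiableWithinAt ?_
    refine Complex.differentiableAt_exp.mul (DifferentiableAt.comp w (g := H) ?_
      Complex.differentiableAt_exp)
    refine DifferentiableAt.const_mul (DifferentiableAt.fun_sum fun A _ => ?_) _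
    refine (hslice.differentiableAt_leftCoord hθ hJ (hlow w hw) A).mul
      (ClosedOperator.differentiableAt_complexify_leftResolvent hJ
        (hT.eventually_mem_resolventSet hω hJ ((hup w hw).trans_lt ?_)) (Γ A))
    exact mul_lt_mul_of_pos_right (cos_lt_cos hω hψ) (norm_pos_iff.2 (Complex.exp_ne_zero w))
  set κ : Finset (Fin n) → ℝ := fun A => ‖Γ A‖ *
    (1 + ‖(leftMulL J : CliffordModule n E →L[ℝ] CliffordModule n E)‖) with hκ
  set K : ℝ := (∑ A, ‖leftCoord J A‖ * κ A) * C with hK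
  have hκ0 : ∀ A, 0 ≤ κ A := fun A => by positivity
  have hK0 : 0 ≤ K := mul_nonneg
    (Finset.sum_nonneg fun A _ => mul_nonneg (norm_nonneg _) (hκ0 A)) hC0
  -- The Jacobian `|e^w| = |z|` cancels the resolvent bound `C/|z|`. What remains is bounded because
  -- `f` is, and integrable on lines because `|f|/t` is integrable on rays.
  have hbound : ∀ w ∈ Complex.im ⁻¹' Ioo a b, ‖h w‖ ≤ K * ‖f (plane J (Complex.exp w))‖ := by
    intro w hw
    set z := Complex.exp w with hz
    have hz0 : 0 < ‖z‖ := norm_pos_iff.2 (Complex.exp_ne_zero w)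
    have hG := hC J hJ z (Complex.exp_ne_zero w) (hup w hw)
    have h1 : ‖∑ A, leftCoord J A (f (plane J z)) *
        complexify J (Γ A) (T.leftResolvent (plane J z))‖ ≤
        (∑ A, ‖leftCoord J A‖ * κ A) * (‖f (plane J z)‖ * (C / ‖z‖)) := by
      rw [Finset.sum_mul]
      refine norm_sum_le_of_le _ fun A _ => ?_
      rw [norm_mul]
      calc _ ≤ (‖leftCoord J A‖ * ‖f (plane J z)‖) * (κ A * (C / ‖z‖)) := by
            refine mul_le_mul ((leftCoord J A).le_opNorm _) ?_ (norm_nonneg _) (by positivity)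
            exact (norm_complexify_le J (Γ A) _).trans (mul_le_mul_of_nonneg_left hG (hκ0 A))
        _ = _ := by ring
    calc ‖h w‖ = ‖z‖ * (2⁻¹ * ‖∑ A, leftCoord J A (f (plane J z)) *
          complexify J (Γ A) (T.leftResolvent (plane J z))‖) := by
          simp [hh, hH, ← hz, div_eq_mul_inv]
      _ ≤ ‖z‖ * (1 * ((∑ A, ‖leftCoord J A‖ * κ A) * (‖f (plane J z)‖ * (C / ‖z‖)))) := by
          gcongr
          norm_num
      _ = K * ‖f (plane J z)‖ := by
          rw [hK]
          field_simp
  have hM' : ∀ w ∈ Complex.im ⁻¹' Ioo a b, ‖h w‖ ≤ K * M := fun w hw =>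
    (hbound w hw).trans (mul_le_mul_of_nonneg_left
      (hM _ ((mem_doubleSector_plane hθ hJ).2 (hlow w hw))) hK0)
  have hline : ∀ (α u : ℝ), Complex.exp (u + α * Complex.I) =
      Real.exp u * Complex.exp (α * Complex.I) := fun α u => by
    rw [Complex.exp_add, Complex.ofReal_exp]
  have hi : ∀ α ∈ Ioo a b, Integrable fun u : ℝ => h (u + α * Complex.I) := by
    intro α hα
    have hcont : Continuous fun u : ℝ => h (u + α * Complex.I) :=
      continuousOn_univ.1 (hd.continuousOn.comp (by fun_prop) fun u _ =>
        add_mul_I_mem_strip hα u)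
    have h1 := (integrable_exp_smul_comp_exp.2 (hint J hJ α (hab hα))).const_mul K
    refine h1.mono' hcont.aestronglyMeasurable (Eventually.of_forall fun u => ?_)
    refine (hbound _ (add_mul_I_mem_strip hα u)).trans (le_of_eq ?_)
    rw [smul_expJ, hline, smul_eq_mul, mul_div_cancel₀ _ (Real.exp_pos u).ne']
  have key : ∀ α ∈ Ioo a b, Λ (∫ r in Ioi 0, rayIntegrand T f J α r) =
      (∫ u : ℝ, h (u + α * Complex.I)).re := by
    intro α hα
    have h1 := Complex.reCLM.integral_comp_comm (hi α hα)
    have h2 := Λ.integral_comp_comm (hint' α hα)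
    rw [← h2, ← integral_exp_smul_comp_exp, ← Complex.reCLM_apply, ← h1]
    refine integral_congr_ae (Eventually.of_forall fun u => ?_)
    simp only [rayIntegrand]
    rw [dual_comp_leftMulL hJ, smul_eq_mul, ← Complex.re_ofReal_mul, Complex.reCLM_apply, ← hline]
    congr 1
    simp only [hh, hH]
    rw [hline]
    ring
  rw [key α hα, key β hβ, integral_line_eq_of_bounded_strip hd hM' hi hα hβ]

/-- The contributions of two conjugate rays together do not depend on the plane `ℂ_J`. -/
theorem rayIntegrand_neg_sub_rayIntegrand (hθ : θ ∈ Ioo 0 (π / 2))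
    (hf : IsLeftSliceHyperholomorphic (doubleSector n θ) f) {α : ℝ} (hα : α ∈ angles θ) {r : ℝ}
    (hr : 0 < r) {J₁ J₂ : Cl n} (hJ₁ : J₁ ∈ unitSphere n) (hJ₂ : J₂ ∈ unitSphere n) :
    rayIntegrand T f J₁ (-α) r - rayIntegrand T f J₁ α r =
      rayIntegrand T f J₂ (-α) r - rayIntegrand T f J₂ α r := by
  obtain ⟨f₀, f₁, -, -, h⟩ := hf
  set z : ℂ := r * Complex.exp (α * Complex.I) with hz
  have hz' : (r * Complex.exp ((-α : ℝ) * Complex.I) : ℂ) = starRingEnd ℂ z := by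
    rw [hz, map_mul, Complex.conj_ofReal, ← Complex.exp_conj]
    simp
  have hmem : Real.cos θ * ‖z‖ < |z.re| := by
    rw [hz, abs_re_ray hr, norm_ray hr]
    exact mul_lt_mul_of_pos_right (cos_lt_abs_cos hθ hα) hr
  obtain ⟨hf1, -, -, -, -⟩ := h z.re z.im (mem_sliceDomain hθ hmem)
  obtain ⟨-, he, ho, -, -⟩ := h z.re z.im (mem_sliceDomain hθ hmem)
  have hmem' : Real.cos θ * ‖starRingEnd ℂ z‖ < |(starRingEnd ℂ z).re| := by
    rwa [RCLike.norm_conj, Complex.conj_re]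
  obtain ⟨hf2, -, -, -, -⟩ := h z.re (-z.im) (mem_sliceDomain hθ hmem')
  rw [he, ho] at hf2
  set Q := T.QInv (plane J₁ z) with hQ
  set P := T.TQInv (plane J₁ z) with hP
  -- Conjugation reverses the signs of `sin α`, `Im z` and `f₁`. In the expanded product the terms
  -- containing `J` are even under this and cancel in the difference; those free of `J` are odd and
  -- double, whence the factor `-2`.
  suffices key : ∀ J ∈ unitSphere n, rayIntegrand T f J (-α) r - rayIntegrand T f J α r =
      (-2 : ℝ) • ((Real.sin α • (z.re • Q - P) - (Real.cos α * z.im) • Q) ∘L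
        leftMulL (f₀ (z.re, z.im)) + (Real.cos α • (z.re • Q - P) + (Real.sin α * z.im) • Q) ∘L
        leftMulL (f₁ (z.re, z.im))) by
    rw [key J₁ hJ₁, key J₂ hJ₂]
  intro J hJ
  have hJJ : ∀ v : CliffordModule n E, leftMulL J (leftMulL J v) = -v := fun v => by
    rw [leftMulL_apply, leftMulL_apply, leftMul_leftMul, unitSphere_mul_self hJ, ← leftMulL_apply,
      leftMulL_neg, leftMulL_one]
    rfl
  have q1 : T.QInv (plane J z) = Q := T.QInv_congr
    (by rw [re_plane hJ, re_plane hJ₁]) (by rw [norm_plane hJ, norm_plane hJ₁])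
  have p1 : T.TQInv (plane J z) = P := T.TQInv_congr
    (by rw [re_plane hJ, re_plane hJ₁]) (by rw [norm_plane hJ, norm_plane hJ₁])
  have q2 : T.QInv (plane J (starRingEnd ℂ z)) = Q := T.QInv_congr
    (by rw [re_plane hJ, re_plane hJ₁, Complex.conj_re])
    (by rw [norm_plane hJ, norm_plane hJ₁, RCLike.norm_conj])
  have p2 : T.TQInv (plane J (starRingEnd ℂ z)) = P := T.TQInv_congr
    (by rw [re_plane hJ, re_plane hJ₁, Complex.conj_re])
    (by rw [norm_plane hJ, norm_plane hJ₁, RCLike.norm_conj])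
  have g1 : f (plane J z) = f₀ (z.re, z.im) + J * f₁ (z.re, z.im) := hf1 J hJ
  have g2 : f (plane J (starRingEnd ℂ z)) = f₀ (z.re, z.im) + J * -f₁ (z.re, z.im) := hf2 J hJ
  rw [rayIntegrand, rayIntegrand, hz', ← hz, T.leftResolvent_plane hJ, T.leftResolvent_plane hJ,
    q1, q2, p1, p2, g1, g2, ← expJ_eq_plane, ← expJ_eq_plane, expJ, expJ, slicePoint, slicePoint,
    Complex.conj_re, Complex.conj_im, Real.cos_neg, Real.sin_neg]
  ext1 v
  simp only [leftMulL_mul, leftMulL_add, leftMulL_smul, leftMulL_neg, leftMulL_one,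
    _root_.sub_apply, _root_.add_apply, _root_.smul_apply, _root_.neg_apply,
    ContinuousLinearMap.comp_apply, one_apply_eq_self, map_add, map_smul, hJJ, map_neg]
  module

/-- The integral along a path made of an incoming and an outgoing ray. -/
theorem integrable_pathIntegrand_of_rays {γ : ℝ → Cl n} {α β : ℝ}
    (hα : IntegrableOn (rayIntegrand T f J α) (Ioi 0))
    (hβ : IntegrableOn (rayIntegrand T f J β) (Ioi 0))
    (hγ₁ : ∀ t, 0 < t → γ t = t • expJ J α) (hγ₂ : ∀ t, t < 0 → γ t = (-t) • expJ J β) :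
    Integrable (pathIntegrand T.leftResolvent f J γ) ∧
      ∫ t, pathIntegrand T.leftResolvent f J γ t =
        (∫ r in Ioi 0, rayIntegrand T f J α r) - ∫ r in Ioi 0, rayIntegrand T f J β r := by
  have e1 : EqOn (pathIntegrand T.leftResolvent f J γ) (rayIntegrand T f J α) (Ioi 0) := by
    intro t ht
    have hd : deriv γ t = expJ J α := by
      have : γ =ᶠ[𝓝 t] fun t => t • expJ J α := by
        filter_upwards [Ioi_mem_nhds (show (0 : ℝ) < t from ht)] with s hs using hγ₁ s hs
      rw [this.deriv_eq]
      simpa using ((hasDerivAt_id t).smul_const (expJ J α)).deriv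
    rw [pathIntegrand, hd, hγ₁ t ht, smul_expJ, expJ_eq_plane, rayIntegrand]
  have e2 : EqOn (pathIntegrand T.leftResolvent f J γ) (fun t => -rayIntegrand T f J β (-t))
      (Iio 0) := by
    intro t ht
    have hd : deriv γ t = -expJ J β := by
      have : γ =ᶠ[𝓝 t] fun t => (-t) • expJ J β := by
        filter_upwards [Iio_mem_nhds (show t < (0 : ℝ) from ht)] with s hs using hγ₂ s hs
      rw [this.deriv_eq]
      simpa using ((hasDerivAt_neg t).smul_const (expJ J β)).deriv
    simp only
    rw [pathIntegrand, hd, hγ₂ t ht, smul_expJ, expJ_eq_plane, rayIntegrand, neg_mul, neg_mul,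
      leftMulL_neg, ContinuousLinearMap.comp_neg]
  have i1 : IntegrableOn (pathIntegrand T.leftResolvent f J γ) (Ioi 0) :=
    (integrableOn_congr_fun e1 measurableSet_Ioi).2 hα
  have hβ' : IntegrableOn (fun t => rayIntegrand T f J β (-t)) (Iio 0) := by
    have := (Measure.measurePreserving_neg (volume : Measure ℝ)).integrableOn_comp_preimage
      (Homeomorph.neg ℝ).measurableEmbedding (f := rayIntegrand T f J β) (s := Ioi 0)
    simpa [Function.comp_def] using this.2 hβ
  -- The value at the vertex `t = 0`, where nothing is assumed about `γ`, is irrelevant: a point is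
  -- a null set.
  have i2 : IntegrableOn (pathIntegrand T.leftResolvent f J γ) (Iic 0) :=
    ((integrableOn_congr_fun e2 measurableSet_Iio).2 hβ'.neg).congr_set_ae Iio_ae_eq_Iic.symm
  have i3 : Integrable (pathIntegrand T.leftResolvent f J γ) := by
    rw [← integrableOn_univ, ← Iic_union_Ioi (a := (0 : ℝ))]
    exact i2.union i1
  refine ⟨i3, ?_⟩
  rw [← intervalIntegral.integral_Iic_add_Ioi i2 i1, setIntegral_congr_fun measurableSet_Ioi e1,
    integral_Iic_eq_integral_Iio, setIntegral_congr_fun measurableSet_Iio e2,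
    ← integral_Iic_eq_integral_Iio, integral_neg, integral_comp_neg_Iic, neg_zero]
  abel

theorem isRightLinear_contourIntegral (φ : ℝ) (J : Cl n) :
    IsRightLinear (contourIntegral T f φ J) :=
  (rightLinearSubmodule n E).add_mem
    (isRightLinear_integral fun _ =>
      (T.isRightLinear_leftResolvent _).comp (isRightLinear_leftMulL _))
    (isRightLinear_integral fun _ =>
      (T.isRightLinear_leftResolvent _).comp (isRightLinear_leftMulL _))

/-! ### The boundary of the double sector as four rays. -/

theorem expJ_pi_sub (J : Cl n) (φ : ℝ) : expJ J (π - φ) = -expJ J (-φ) := by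
  simp only [expJ, slicePoint, Real.cos_pi_sub, Real.sin_pi_sub, Real.cos_neg, Real.sin_neg]
  module

theorem expJ_pi_add (J : Cl n) (φ : ℝ) : expJ J (π + φ) = -expJ J φ := by
  simp only [expJ, slicePoint, add_comm π, Real.cos_add_pi, Real.sin_add_pi]
  module

theorem gammaPlus_of_pos {t : ℝ} (ht : 0 < t) (φ : ℝ) :
    gammaPlus J φ t = t • expJ J (-φ) := by
  simp [gammaPlus, abs_of_pos ht, sign_pos ht]

theorem gammaPlus_of_neg {t : ℝ} (ht : t < 0) (φ : ℝ) :
    gammaPlus J φ t = (-t) • expJ J φ := by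
  simp [gammaPlus, abs_of_neg ht, sign_neg ht]

theorem angles_mem_of_mem {φ : ℝ} (hω : 0 < ω) (hφ : φ ∈ Ioo ω θ) :
    φ ∈ angles θ ∧ -φ ∈ angles θ ∧ π - φ ∈ angles θ ∧ π + φ ∈ angles θ := by
  have h1 := hφ.1
  have h2 := hφ.2
  refine ⟨Or.inl ⟨?_, ?_⟩, Or.inl ⟨?_, ?_⟩, Or.inr ⟨?_, ?_⟩, Or.inr ⟨?_, ?_⟩⟩ <;> linarith

theorem abs_cos_le {φ : ℝ} (hψ : 0 < ψ) (hθ : θ < π / 2) (hφ : φ ∈ Ioo ψ θ) :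
    |Real.cos φ| ≤ Real.cos ψ ∧ |Real.cos (-φ)| ≤ Real.cos ψ ∧
      |Real.cos (π - φ)| ≤ Real.cos ψ ∧ |Real.cos (π + φ)| ≤ Real.cos ψ := by
  have h : |Real.cos φ| ≤ Real.cos ψ := by
    rw [abs_of_nonneg (Real.cos_nonneg_of_mem_Icc ⟨by linarith [hφ.1, Real.pi_pos],
      by linarith [hφ.2]⟩)]
    exact Real.cos_le_cos_of_nonneg_of_le_pi hψ.le (by linarith [hφ.2, Real.pi_pos]) hφ.1.le
  rw [Real.cos_neg, Real.cos_pi_sub, add_comm π, Real.cos_add_pi, abs_neg]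
  exact ⟨h, h, h, h⟩

/-- The contour integral as a combination of the integrals over the four rays. -/
theorem contourIntegral_eq (hω : ω ∈ Ioo 0 (π / 2)) (hT : T.IsBisectorial ω)
    (hθ : θ ∈ Ioo ω (π / 2)) (hf : f ∈ SHL0 n θ) {φ : ℝ} (hφ : φ ∈ Ioo ω θ)
    (hJ : J ∈ unitSphere n) :
    ContourIntegrable T f φ J ∧ contourIntegral T f φ J =
      ((∫ r in Ioi 0, rayIntegrand T f J (-φ) r) - ∫ r in Ioi 0, rayIntegrand T f J φ r) +
      ((∫ r in Ioi 0, rayIntegrand T f J (π - φ) r) -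
        ∫ r in Ioi 0, rayIntegrand T f J (π + φ) r) := by
  have hθ' : θ ∈ Ioo 0 (π / 2) := ⟨hω.1.trans hθ.1, hθ.2⟩
  -- The resolvent estimate is not assumed at the angle `ω` itself, so an intermediate angle is
  -- inserted below `φ`.
  obtain ⟨ψ, hψ1, hψ2⟩ := exists_between hφ.1
  have hψ : ψ ∈ Ioo ω (π / 2) := ⟨hψ1, by linarith [hφ.2, hθ.2]⟩
  obtain ⟨a1, a2, a3, a4⟩ := angles_mem_of_mem hω.1 hφ
  obtain ⟨c1, c2, c3, c4⟩ := abs_cos_le (hω.1.trans hψ1) hθ.2 ⟨hψ2, hφ.2⟩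
  have hi := fun α h h' => integrableOn_rayIntegrand (α := α) hω hT hθ' hf hψ hJ h h'
  obtain ⟨p1, p2⟩ := integrable_pathIntegrand_of_rays (hi _ a2 c2) (hi _ a1 c1)
    (fun t ht => gammaPlus_of_pos ht φ) (fun t ht => gammaPlus_of_neg ht φ)
  obtain ⟨m1, m2⟩ := integrable_pathIntegrand_of_rays (hi _ a3 c3) (hi _ a4 c4)
    (γ := gammaMinus J φ)
    (fun t ht => by rw [gammaMinus, gammaPlus_of_pos ht, expJ_pi_sub, smul_neg])
    (fun t ht => by rw [gammaMinus, gammaPlus_of_neg ht, expJ_pi_add, smul_neg])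
  exact ⟨⟨p1, m1⟩, by rw [contourIntegral, p2, m2]⟩

/-- Each ray moves within its own component between `D_ψ` and `D_θ`, for one `ψ` below both angles.
No cancellation between different rays is involved. -/
theorem contourIntegral_eq_of_angle (hω : ω ∈ Ioo 0 (π / 2)) (hT : T.IsBisectorial ω)
    (hθ : θ ∈ Ioo ω (π / 2)) (hf : f ∈ SHL0 n θ) {φ₁ φ₂ : ℝ} (hφ₁ : φ₁ ∈ Ioo ω θ)
    (hφ₂ : φ₂ ∈ Ioo ω θ) (hJ : J ∈ unitSphere n) :
    contourIntegral T f φ₁ J = contourIntegral T f φ₂ J := by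
  have hθ' : θ ∈ Ioo 0 (π / 2) := ⟨hω.1.trans hθ.1, hθ.2⟩
  obtain ⟨ψ, hψ1, hψ2⟩ := exists_between (lt_min hφ₁.1 hφ₂.1)
  have hψ : ψ ∈ Ioo ω (π / 2) :=
    ⟨hψ1, by linarith [hψ2.trans_le (min_le_left φ₁ φ₂), hφ₁.2, hθ.2]⟩
  have h1 : φ₁ ∈ Ioo ψ θ := ⟨hψ2.trans_le (min_le_left _ _), hφ₁.2⟩
  have h2 : φ₂ ∈ Ioo ψ θ := ⟨hψ2.trans_le (min_le_right _ _), hφ₂.2⟩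
  have ha := fun φ (h : φ ∈ Ioo ψ θ) => angles_mem_of_mem (hω.1.trans hψ1) h
  have hc := fun φ (h : φ ∈ Ioo ψ θ) => abs_cos_le (hω.1.trans hψ1) hθ.2 h
  have neg_mem : ∀ φ, φ ∈ Ioo (-θ) (-ψ) → -φ ∈ Ioo ψ θ := fun φ h =>
    ⟨by linarith [h.2], by linarith [h.1]⟩
  have sub_mem : ∀ φ, φ ∈ Ioo (π - θ) (π - ψ) → π - φ ∈ Ioo ψ θ := fun φ h =>
    ⟨by linarith [h.2], by linarith [h.1]⟩
  have add_mem : ∀ φ, φ ∈ Ioo (π + ψ) (π + θ) → φ - π ∈ Ioo ψ θ := fun φ h =>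
    ⟨by linarith [h.1], by linarith [h.2]⟩
  have k1 := integral_rayIntegrand_eq hω hT hθ' hf hψ hJ (fun φ h => (ha φ h).1)
    (fun φ h => (hc φ h).1) h1 h2
  have k2 := integral_rayIntegrand_eq hω hT hθ' hf hψ hJ (a := -θ) (b := -ψ) (α := -φ₁) (β := -φ₂)
    (fun φ h => by simpa using (ha _ (neg_mem φ h)).2.1)
    (fun φ h => by simpa using (hc _ (neg_mem φ h)).1)
    ⟨by linarith [h1.2], by linarith [h1.1]⟩ ⟨by linarith [h2.2], by linarith [h2.1]⟩
  have k3 := integral_rayIntegrand_eq hω hT hθ' hf hψ hJ (a := π - θ) (b := π - ψ) (α := π - φ₁)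
    (β := π - φ₂) (fun φ h => by simpa using (ha _ (sub_mem φ h)).2.2.1)
    (fun φ h => by simpa using (hc _ (sub_mem φ h)).1)
    ⟨by linarith [h1.2], by linarith [h1.1]⟩ ⟨by linarith [h2.2], by linarith [h2.1]⟩
  have k4 := integral_rayIntegrand_eq hω hT hθ' hf hψ hJ (a := π + ψ) (b := π + θ) (α := π + φ₁)
    (β := π + φ₂) (fun φ h => by simpa using (ha _ (add_mem φ h)).2.2.2)
    (fun φ h => by simpa using (hc _ (add_mem φ h)).1)
    ⟨by linarith [h1.1], by linarith [h1.2]⟩ ⟨by linarith [h2.1], by linarith [h2.2]⟩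
  rw [(contourIntegral_eq hω hT hθ hf hφ₁ hJ).2, (contourIntegral_eq hω hT hθ hf hφ₂ hJ).2, k1, k2,
    k3, k4]

theorem contourIntegral_eq_of_unitSphere (hω : ω ∈ Ioo 0 (π / 2)) (hT : T.IsBisectorial ω)
    (hθ : θ ∈ Ioo ω (π / 2)) (hf : f ∈ SHL0 n θ) {φ : ℝ} (hφ : φ ∈ Ioo ω θ) {J₁ J₂ : Cl n}
    (hJ₁ : J₁ ∈ unitSphere n) (hJ₂ : J₂ ∈ unitSphere n) :
    contourIntegral T f φ J₁ = contourIntegral T f φ J₂ := by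
  have hθ' : θ ∈ Ioo 0 (π / 2) := ⟨hω.1.trans hθ.1, hθ.2⟩
  obtain ⟨ψ, hψ1, hψ2⟩ := exists_between hφ.1
  have hψ : ψ ∈ Ioo ω (π / 2) := ⟨hψ1, by linarith [hφ.2, hθ.2]⟩
  obtain ⟨a1, a2, a3, a4⟩ := angles_mem_of_mem hω.1 hφ
  obtain ⟨c1, c2, c3, c4⟩ := abs_cos_le (hω.1.trans hψ1) hθ.2 ⟨hψ2, hφ.2⟩
  have hi : ∀ J ∈ unitSphere n, ∀ α ∈ angles θ, |Real.cos α| ≤ Real.cos ψ →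
      Integrable (rayIntegrand T f J α) (volume.restrict (Ioi 0)) := fun J hJ α h h' =>
    integrableOn_rayIntegrand hω hT hθ' hf hψ hJ h h'
  -- The angles `π - φ` and `-(π + φ)` differ by `2π`, so the two left rays are also a conjugate
  -- pair `±α`, with `α = π + φ`.
  have hper : ∀ J : Cl n, rayIntegrand T f J (π - φ) = rayIntegrand T f J (-(π + φ)) := by
    intro J
    have : Complex.exp ((π - φ : ℝ) * Complex.I) = Complex.exp ((-(π + φ) : ℝ) * Complex.I) := by
      rw [← Complex.exp_periodic ((-(π + φ) : ℝ) * Complex.I)]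
      congr 1
      push_cast
      ring
    funext r
    rw [rayIntegrand, rayIntegrand, this]
  rw [(contourIntegral_eq hω hT hθ hf hφ hJ₁).2, (contourIntegral_eq hω hT hθ hf hφ hJ₂).2,
    ← integral_sub (hi J₁ hJ₁ _ a2 c2) (hi J₁ hJ₁ _ a1 c1),
    ← integral_sub (hi J₁ hJ₁ _ a3 c3) (hi J₁ hJ₁ _ a4 c4),
    ← integral_sub (hi J₂ hJ₂ _ a2 c2) (hi J₂ hJ₂ _ a1 c1),
    ← integral_sub (hi J₂ hJ₂ _ a3 c3) (hi J₂ hJ₂ _ a4 c4), hper, hper]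
  congr 1
  · exact setIntegral_congr_fun measurableSet_Ioi fun r hr =>
      rayIntegrand_neg_sub_rayIntegrand hθ' hf.1 a1 hr hJ₁ hJ₂
  · exact setIntegral_congr_fun measurableSet_Ioi fun r hr =>
      rayIntegrand_neg_sub_rayIntegrand hθ' hf.1 a4 hr hJ₁ hJ₂

end Rays

end CliffordCalculus

/-! ### The operator `f(T)`. -/

open CliffordCalculus
theorem mainTheorem1 {n : ℕ} {E : Type*} [NormedAddCommGroup E] [NormedSpace ℝ E]
    [CompleteSpace E] (T : ClosedOperator n E) {ω : ℝ} (hω : ω ∈ Set.Ioo 0 (Real.pi / 2))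
    (hT : T.IsBisectorial ω) {θ : ℝ} (hθ : θ ∈ Set.Ioo ω (Real.pi / 2))
    {f : Cl n → Cl n} (hf : f ∈ SHL0 n θ) :
    (∀ φ ∈ Set.Ioo ω θ, ∀ J ∈ unitSphere n,
      ContourIntegrable T f φ J ∧ IsRightLinear (contourIntegral T f φ J)) ∧
    (∀ φ₁ ∈ Set.Ioo ω θ, ∀ φ₂ ∈ Set.Ioo ω θ, ∀ J₁ ∈ unitSphere n, ∀ J₂ ∈ unitSphere n,
      contourIntegral T f φ₁ J₁ = contourIntegral T f φ₂ J₂) ∧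
    (∃ A : CliffordModule n E →L[ℝ] CliffordModule n E, IsRightLinear A ∧
      ∀ φ ∈ Set.Ioo ω θ, ∀ J ∈ unitSphere n,
        A = (2 * Real.pi)⁻¹ • contourIntegral T f φ J) := by
  have hind : ∀ φ₁ ∈ Set.Ioo ω θ, ∀ φ₂ ∈ Set.Ioo ω θ, ∀ J₁ ∈ unitSphere n,
      ∀ J₂ ∈ unitSphere n, contourIntegral T f φ₁ J₁ = contourIntegral T f φ₂ J₂ :=
    fun φ₁ hφ₁ φ₂ hφ₂ J₁ hJ₁ J₂ hJ₂ =>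
      (contourIntegral_eq_of_angle hω hT hθ hf hφ₁ hφ₂ hJ₁).trans
        (contourIntegral_eq_of_unitSphere hω hT hθ hf hφ₂ hJ₁ hJ₂)
  refine ⟨fun φ hφ J hJ => ⟨(contourIntegral_eq hω hT hθ hf hφ hJ).1,
    isRightLinear_contourIntegral φ J⟩, hind, ?_⟩
  obtain ⟨φ₀, hφ₀⟩ := exists_between hθ.1
  -- For `n = 0` there are no imaginary units, the condition on `A` is vacuous, and `0` serves as
  -- witness.
  rcases (unitSphere n).eq_empty_or_nonempty with hS | ⟨J₀, hJ₀⟩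
  · exact ⟨0, (rightLinearSubmodule n E).zero_mem, by simp [hS]⟩
  · exact ⟨(2 * Real.pi)⁻¹ • contourIntegral T f φ₀ J₀,
      (rightLinearSubmodule n E).smul_mem _ (isRightLinear_contourIntegral φ₀ J₀),
      fun φ hφ J hJ => by rw [hind φ₀ hφ₀ φ hφ J₀ hJ₀ J hJ]⟩
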